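/- Let $\mathcal F$ be the fermionic Fock space over $\mathbb C$ with vacuum $|vac\rangle$, generated by modes $\psi_r,\psi^*_r$ ($r\in\mathbb Z+\frac12$) satisfying $\{\psi_r,\psi_s\}=\{\psi^*_r,\psi^*_s\}=0$, $\{\psi_r,\psi^*_s\}=\delta_{r+s,0}$ and $\psi_r|vac\rangle=\psi^*_r|vac\rangle=0$ for $r>0$, and let $:\ :$ be fermionic normal ordering (modes of positive index to the right, with sign). Put $\tilde a_n=\sum_{r\in\mathbb Z+1/2}:\psi_{n-r}\psi^*_r:$ for $n\in\mathbb Z$, and let $\mathcal F_0=\ker\tilde a_0$ be the charge-zero sector. Let $b\in\mathbb C$, $b\neq0$, put $a_{-n}=b\,\tilde a_{-n}$, $a_n=b^{-1}\tilde a_n$ for $n>0$, and let $$H=\sum_{n,m>0}b\,(a_{-n}a_{-m}a_{n+m}+a_{-n-m}a_na_m)+(1-b^2)\sum_{n>0}n\,a_{-n}a_n$$ be the bosonic Calogero--Sutherland Hamiltonian. In all fermionic sums below the indices $r,s,k,l$ run over $\mathbb Z+\frac12$. Then all infinite sums of operators here and below have only finitely many nonzero terms on each vector of $\mathcal F$,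 $[\tilde a_m,\tilde a_n]=m\,\delta_{m+n,0}$ for all $m,n\in\mathbb Z$, $\tilde a_n|vac\rangle=0$ for $n\ge0$, and $H=H_0+H_1+H_2$ with $$H_0=\sum_{n,m>0}(\tilde a_{-n}\tilde a_{-m}\tilde a_{n+m}+\tilde a_{-n-m}\tilde a_n\tilde a_m),\quad H_1=-(1-b^2)\sum_{n,m>0}\tilde a_{-n}\tilde a_{-m}\tilde a_{n+m},\quad H_2=(1-b^2)\sum_{n>0}n\,\tilde a_{-n}\tilde a_n .$$ Moreover, on $\mathcal F_0$, $$H_0=\sum_{k>0}\Bigl(k^2+\tfrac34\Bigr)(\psi_{-k}\psi^*_k-\psi^*_{-k}\psi_k),$$ $$H_1=\tfrac23(1-b^2)\Bigl(\sum_{\substack{r+s<0,\ k+l>0\\ r+s+k+l=0}}\bigl(\tfrac12(s-r)+k-l\bigr):\psi_r\psi^*_s\psi_k\psi^*_l:-\tfrac1{16}\sum_{k>0}(6k-1)(2k-1)(\psi_{-k}\psi^*_k-\psi^*_{-k}\psi_k)\Bigr),$$ $$H_2=(1-b^2)\Bigl(\sum_{\substack{r+s<0,\ k+l>0\\ r+s+k+l=0}}(k+l):\psi_r\psi^*_s\psi_k\psi^*_l:+\sum_{k>0}\tfrac12\bigl(k^2-\tfrac14\bigr)(\psi_{-k}\psi^*_k+\psi^*_{-k}\psi_k)\Bigr),$$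 so that $H$ is the sum of these three fermionic expressions, and $$H=H_0+(1-b^2)H_d+(1-b^2)H_t,$$ where $$H_d=\sum_{k>0}\Bigl(\tfrac13\bigl(k-\tfrac12\bigr)\psi_{-k}\psi^*_k+\bigl(k-\tfrac12\bigr)\bigl(k+\tfrac16\bigr)\psi^*_{-k}\psi_k\Bigr)+\sum_{k+l>0}\tfrac23(2k+l):\psi_{-l}\psi^*_{-k}\psi_k\psi^*_l:\,,$$ $$H_t=\sum_{\substack{k+l>0,\ k+s\neq0}}\bigl(2k+\tfrac23(s+l)\bigr):\psi_{-s-k-l}\psi^*_s\psi_k\psi^*_l:\,.$$ -/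

import Mathlib

namespace CSFermion

/-- Half-integers are indexed by integers: `j : ℤ` stands for the half-integer `j + 1/2`.
`hf j` is its value. -/
def hf (j : ℤ) : ℚ := (j : ℚ) + 1 / 2

/-- The index of the half-integer `-(j + 1/2)`. -/
def opp (j : ℤ) : ℤ := -1 - j

theorem hf_opp (j : ℤ) : hf (opp j) = -hf j := by
  simp only [hf, opp]
  push_cast
  ring

/-- The fermionic Fock space: the exterior algebra on the creation modes, where
`Sum.inl m` is the mode `ψ_{-(m+1/2)}` and `Sum.inr m` is the mode `ψ*_{-(m+1/2)}`, `m ≥ 0`. -/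
abbrev Fock : Type := ExteriorAlgebra ℂ ((ℕ ⊕ ℕ) →₀ ℂ)

/-- Linear operators on the Fock space (multiplication is composition). -/
abbrev Op : Type := Module.End ℂ Fock

/-- The vacuum vector. -/
noncomputable def vac : Fock := 1

/-- Exterior multiplication by a basis vector. -/
noncomputable def create (i : ℕ ⊕ ℕ) : Op :=
  LinearMap.mulLeft ℂ (ExteriorAlgebra.ι ℂ (Finsupp.single i (1 : ℂ)))

/-- Contraction with a dual basis vector: the antiderivation adjoint to `create i`. -/
noncomputable def annihilate (i : ℕ ⊕ ℕ) : Op :=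
  CliffordAlgebra.contractLeft (Q := (0 : QuadraticForm ℂ ((ℕ ⊕ ℕ) →₀ ℂ)))
    (Finsupp.lapply i : ((ℕ ⊕ ℕ) →₀ ℂ) →ₗ[ℂ] ℂ)

/-- `ψ j` is the fermion mode `ψ_{j+1/2}`; it creates if `j + 1/2 < 0` and annihilates if
`j + 1/2 > 0`.  For `m ≥ 0`, `ψ_{m+1/2}` is conjugate to `ψ*_{-(m+1/2)}`. -/
noncomputable def ψ : ℤ → Op
  | Int.ofNat m => annihilate (Sum.inr m)
  | Int.negSucc m => create (Sum.inl m)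

/-- `ψs j` is the fermion mode `ψ*_{j+1/2}`. -/
noncomputable def ψs : ℤ → Op
  | Int.ofNat m => annihilate (Sum.inl m)
  | Int.negSucc m => create (Sum.inr m)

/-- A symbol for a fermion mode: `Mode.psi j` for `ψ_{j+1/2}`, `Mode.psiStar j` for
`ψ*_{j+1/2}`. -/
inductive Mode : Type
  | psi (j : ℤ) : Mode
  | psiStar (j : ℤ) : Mode

/-- The half-integer index of a mode symbol. -/
def Mode.index : Mode → ℚ
  | Mode.psi j => hf j
  | Mode.psiStar j => hf j

/-- The operator of a mode symbol. -/
noncomputable def Mode.op : Mode → Op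
  | Mode.psi j => ψ j
  | Mode.psiStar j => ψs j

/-- Fermionic normal ordering `:x₁ x₂ ⋯ xₚ:` with respect to the vacuum: annihilation modes
(positive index) are moved to the right of creation modes (negative index), each
transposition of two modes costing a sign. -/
noncomputable def normalOrder : List Mode → Op
  | [] => 1
  | x :: L =>
    if x.index < 0 then x.op * normalOrder L
    else ((-1 : ℂ) ^ L.length) • (normalOrder L * x.op)

/-- `:ψ_q ψ*_r:` -/
noncomputable def no2 (q r : ℤ) : Op := normalOrder [Mode.psi q, Mode.psiStar r]

/-- `:ψ_r ψ*_s ψ_k ψ*_l:` -/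
noncomputable def no4 (r s k l : ℤ) : Op :=
  normalOrder [Mode.psi r, Mode.psiStar s, Mode.psi k, Mode.psiStar l]

/-- A family of operators only finitely many of which are nonzero on any given vector. -/
def PointwiseFinite {ι : Type} (T : ι → Op) : Prop :=
  ∀ v : Fock, {i | T i v ≠ 0}.Finite

open Classical in
/-- The sum of a pointwise finite family of operators, `v ↦ ∑ᵢ Tᵢ v`
(set to `0` if the family is not pointwise finite). -/
noncomputable def opSum {ι : Type} (T : ι → Op) : Op :=
  if h : PointwiseFinite T then
    { toFun := fun v => ∑ᶠ i, T i v
      map_add' := fun v w => by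
        simp only [map_add]
        exact finsum_add_distrib (h v) (h w)
      map_smul' := fun c v => by
        simp only [map_smul, RingHom.id_apply]
        exact (smul_finsum' c (h v)).symm }
  else 0

theorem opSum_apply {ι : Type} {T : ι → Op} (h : PointwiseFinite T) (v : Fock) :
    opSum T v = ∑ᶠ i, T i v := by
  simp [opSum, h]

/-! ### Bosonic modes -/

/-- Summands of `ã_n = ∑_r :ψ_{n-r} ψ*_r:`, written as a sum over pairs `q + r = n`. -/
noncomputable def aTildeTerm (n : ℤ) (p : ℤ × ℤ) : Op :=
  if hf p.1 + hf p.2 = n then no2 p.1 p.2 else 0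

/-- `ã_n = ∑_{r ∈ ℤ+1/2} :ψ_{n-r} ψ*_r:` -/
noncomputable def aTilde (n : ℤ) : Op := opSum (aTildeTerm n)

/-- The charge-zero sector, the kernel of the charge `ã_0 = ∑_r :ψ_{-r} ψ*_r:`. -/
noncomputable def chargeZero : Submodule ℂ Fock := LinearMap.ker (aTilde 0)

/-- The undeformed modes: `a_{-n} = b ã_{-n}` and `a_n = b⁻¹ ã_n` for `n > 0`
(and `a_0 = ã_0`, which is not used). -/
noncomputable def aMode (b : ℂ) (n : ℤ) : Op :=
  if n < 0 then b • aTilde n else if 0 < n then b⁻¹ • aTilde n else aTilde n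

/-! ### The bosonic Hamiltonian -/

/-- Summands of `∑_{n,m>0} b (a_{-n} a_{-m} a_{n+m} + a_{-n-m} a_n a_m)`. -/
noncomputable def csCubicTerm (b : ℂ) (p : ℤ × ℤ) : Op :=
  if 0 < p.1 ∧ 0 < p.2 then
    b • (aMode b (-p.1) * aMode b (-p.2) * aMode b (p.1 + p.2)
      + aMode b (-p.1 - p.2) * aMode b p.1 * aMode b p.2)
  else 0

/-- Summands of `∑_{n>0} n a_{-n} a_n`. -/
noncomputable def csQuadraticTerm (b : ℂ) (n : ℤ) : Op :=
  if 0 < n then (n : ℂ) • (aMode b (-n) * aMode b n) else 0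

/-- The Calogero–Sutherland Hamiltonian
`H = ∑_{n,m>0} b (a_{-n} a_{-m} a_{n+m} + a_{-n-m} a_n a_m) + (1 - b²) ∑_{n>0} n a_{-n} a_n`. -/
noncomputable def csH (b : ℂ) : Op :=
  opSum (csCubicTerm b) + (1 - b ^ 2) • opSum (csQuadraticTerm b)

/-- Summands of `H_0`. -/
noncomputable def H0Term (p : ℤ × ℤ) : Op :=
  if 0 < p.1 ∧ 0 < p.2 then
    aTilde (-p.1) * aTilde (-p.2) * aTilde (p.1 + p.2)
      + aTilde (-p.1 - p.2) * aTilde p.1 * aTilde p.2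
  else 0

/-- `H_0 = ∑_{n,m>0} (ã_{-n} ã_{-m} ã_{n+m} + ã_{-n-m} ã_n ã_m)` -/
noncomputable def H0 : Op := opSum H0Term

/-- Summands of `∑_{n,m>0} ã_{-n} ã_{-m} ã_{n+m}`. -/
noncomputable def H1Term (p : ℤ × ℤ) : Op :=
  if 0 < p.1 ∧ 0 < p.2 then aTilde (-p.1) * aTilde (-p.2) * aTilde (p.1 + p.2) else 0

/-- `H_1 = (1 - b²) (-∑_{n,m>0} ã_{-n} ã_{-m} ã_{n+m})` -/
noncomputable def H1 (b : ℂ) : Op := (1 - b ^ 2) • (-opSum H1Term)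

/-- Summands of `∑_{n>0} n ã_{-n} ã_n`. -/
noncomputable def H2Term (n : ℤ) : Op :=
  if 0 < n then (n : ℂ) • (aTilde (-n) * aTilde n) else 0

/-- `H_2 = (1 - b²) ∑_{n>0} n ã_{-n} ã_n` -/
noncomputable def H2 (b : ℂ) : Op := (1 - b ^ 2) • opSum H2Term

/-! ### Fermionic expressions -/

/-- Summands of `∑_{k>0} (k² + 3/4) (ψ_{-k} ψ*_k - ψ*_{-k} ψ_k)`. -/
noncomputable def freeTerm (k : ℤ) : Op :=
  if 0 < hf k then
    ((hf k ^ 2 + 3 / 4 : ℚ) : ℂ) • (ψ (opp k) * ψs k - ψs (opp k) * ψ k)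
  else 0

/-- The free-fermion operator `∑_{k>0} (k² + 3/4) (ψ_{-k} ψ*_k - ψ*_{-k} ψ_k)`. -/
noncomputable def freeH : Op := opSum freeTerm

/-- Summands of
`∑_{r+s<0, k+l>0, r+s+k+l=0} ((s - r)/2 + k - l) :ψ_r ψ*_s ψ_k ψ*_l:`, indexed by
`(r, s, k, l)`. -/
noncomputable def F1QuarticTerm : ℤ × ℤ × ℤ × ℤ → Op := fun (r, s, k, l) =>
  if hf r + hf s < 0 ∧ 0 < hf k + hf l ∧ hf r + hf s + hf k + hf l = 0 then
    ((1 / 2 * (hf s - hf r) + hf k - hf l : ℚ) : ℂ) • no4 r s k l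
  else 0

/-- Summands of `∑_{k>0} (6k - 1)(2k - 1) (ψ_{-k} ψ*_k - ψ*_{-k} ψ_k)`. -/
noncomputable def F1QuadraticTerm (k : ℤ) : Op :=
  if 0 < hf k then
    (((6 * hf k - 1) * (2 * hf k - 1) : ℚ) : ℂ) • (ψ (opp k) * ψs k - ψs (opp k) * ψ k)
  else 0

/-- `F_1 = ∑ ((s - r)/2 + k - l) :ψ_r ψ*_s ψ_k ψ*_l:
  - (1/16) ∑_{k>0} (6k - 1)(2k - 1) (ψ_{-k} ψ*_k - ψ*_{-k} ψ_k)` -/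
noncomputable def F1 : Op :=
  opSum F1QuarticTerm - (1 / 16 : ℂ) • opSum F1QuadraticTerm

/-- Summands of `∑_{r+s<0, k+l>0, r+s+k+l=0} (k + l) :ψ_r ψ*_s ψ_k ψ*_l:`. -/
noncomputable def F2QuarticTerm : ℤ × ℤ × ℤ × ℤ → Op := fun (r, s, k, l) =>
  if hf r + hf s < 0 ∧ 0 < hf k + hf l ∧ hf r + hf s + hf k + hf l = 0 then
    ((hf k + hf l : ℚ) : ℂ) • no4 r s k l
  else 0

/-- Summands of `∑_{k>0} (1/2) (k² - 1/4) (ψ_{-k} ψ*_k + ψ*_{-k} ψ_k)`. -/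
noncomputable def F2QuadraticTerm (k : ℤ) : Op :=
  if 0 < hf k then
    ((1 / 2 * (hf k ^ 2 - 1 / 4) : ℚ) : ℂ) • (ψ (opp k) * ψs k + ψs (opp k) * ψ k)
  else 0

/-- `F_2 = ∑ (k + l) :ψ_r ψ*_s ψ_k ψ*_l:
  + ∑_{k>0} (1/2) (k² - 1/4) (ψ_{-k} ψ*_k + ψ*_{-k} ψ_k)` -/
noncomputable def F2 : Op := opSum F2QuarticTerm + opSum F2QuadraticTerm

/-- Summands of
`∑_{k>0} ((1/3) (k - 1/2) ψ_{-k} ψ*_k + (k - 1/2)(k + 1/6) ψ*_{-k} ψ_k)`. -/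
noncomputable def HdQuadraticTerm (k : ℤ) : Op :=
  if 0 < hf k then
    ((1 / 3 * (hf k - 1 / 2) : ℚ) : ℂ) • (ψ (opp k) * ψs k)
      + (((hf k - 1 / 2) * (hf k + 1 / 6) : ℚ) : ℂ) • (ψs (opp k) * ψ k)
  else 0

/-- Summands of `∑_{k+l>0} (2/3) (2k + l) :ψ_{-l} ψ*_{-k} ψ_k ψ*_l:`, indexed by `(k, l)`. -/
noncomputable def HdQuarticTerm : ℤ × ℤ → Op := fun (k, l) =>
  if 0 < hf k + hf l then
    ((2 / 3 * (2 * hf k + hf l) : ℚ) : ℂ) • no4 (opp l) (opp k) k l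
  else 0

/-- The diagonal part `H_d` of the interaction. -/
noncomputable def Hd : Op := opSum HdQuadraticTerm + opSum HdQuarticTerm

/-- Summands of
`∑_{r+s+k+l=0, k+l>0, k+s≠0} (2k + (2/3)(s + l)) :ψ_r ψ*_s ψ_k ψ*_l:`, indexed by
`(r, s, k, l)`; the terms with `k + s = 0` are those of `H_d`. -/
noncomputable def HtTerm : ℤ × ℤ × ℤ × ℤ → Op := fun (r, s, k, l) =>
  if hf r + hf s + hf k + hf l = 0 ∧ 0 < hf k + hf l ∧ hf k + hf s ≠ 0 then
    ((2 * hf k + 2 / 3 * (hf s + hf l) : ℚ) : ℂ) • no4 r s k l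
  else 0

/-- The off-diagonal part `H_t` of the interaction. -/
noncomputable def Ht : Op := opSum HtTerm

end CSFermion

/-! Write `A` for `opSum H1Term` (two creators) and `B` for `opSum splitTerm` (two annihilators).
Rescaling the modes turns the cubic part of `csH b` into `b² A + B = (A + B) - (1 - b²) A`, so it
remains to express `A`, `A + B` and the quadratic sum through fermions.

The tool is Wick's theorem `no2_mul_no2`: a product of two normally ordered bilinears is a quartic
monomial plus contractions. A quartic sum whose coefficient is symmetric in the two `ψ*` indices
vanishes (`eq_zero_of_hasSum_no4`), so the normally ordered square of the current is bilinear: its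
modes `L_n` are `sugawara n`. Hence `P = ∑ L_{-n} ã_n` and `Q = ∑ ã_{-n} L_n` are at most quartic in
fermions. Expanding `L` in bosons instead, every term containing `ã_0` dies on the charge-zero
sector, leaving `P = A + 2B` and `Q = B + 2A`.

Now `P/2 - Q = -(3/2) A` is the formula for `H_1` (`F1_apply`), and `(P + Q)/3 = A + B` is `H_0`.
The quartic coefficient of `P + Q` is symmetric in the `ψ*` indices, but its sum runs only over `k +
l > 0`; completing it to all `k + l` costs the `k + l = 0` part, which in charge zero is bilinear
(`quartic_symm_apply`). So `H_0` is free. `H_2` follows from Wick's theorem alone, and `H_d + H_t`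
merely regroups `(2/3) F_1 + F_2` according to whether `k + s = 0`. -/

namespace CSFermion

/-! ### Summation of operators -/

/-- The ring structure on operators, with subtraction and negation given by `LinearMap`. -/
@[reducible] noncomputable instance : Ring Op :=
  { (inferInstance : Semiring Op), (inferInstance : AddCommGroup Op), (inferInstance : Ring Op) with }

/-- With discrete vectors and pointwise convergence of operators, summability means exactly
pointwise finiteness, so reindexing and iterated sums come from the theory of `HasSum`. -/
noncomputable instance : TopologicalSpace Fock := ⊥

instance : DiscreteTopology Fock := ⟨rfl⟩

/-- The topology of pointwise convergence on operators, for the discrete Fock space. -/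
noncomputable instance : TopologicalSpace Op :=
  TopologicalSpace.induced (fun T : Op => (T : Fock → Fock)) inferInstance

theorem isInducing_coe : Topology.IsInducing (fun T : Op => (T : Fock → Fock)) := ⟨rfl⟩

instance : T2Space Op :=
  Topology.IsEmbedding.t2Space (f := fun T : Op => (T : Fock → Fock))
    ⟨isInducing_coe, DFunLike.coe_injective⟩

instance : RegularSpace Op := isInducing_coe.regularSpace

instance : ContinuousAdd Op :=
  ⟨isInducing_coe.continuous_iff.2 (by
    refine continuous_pi fun v => ?_
    have h : Continuous fun T : Op => T v := (continuous_apply v).comp isInducing_coe.continuous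
    exact (h.comp continuous_fst).add (h.comp continuous_snd))⟩

instance : ContinuousNeg Op :=
  ⟨isInducing_coe.continuous_iff.2 (by
    refine continuous_pi fun v => ?_
    have h : Continuous fun T : Op => T v := (continuous_apply v).comp isInducing_coe.continuous
    exact h.neg)⟩

instance : IsTopologicalAddGroup Op where

instance : ContinuousConstSMul ℂ Op :=
  ⟨fun c => isInducing_coe.continuous_iff.2 (by
    refine continuous_pi fun v => ?_
    have h : Continuous fun T : Op => T v := (continuous_apply v).comp isInducing_coe.continuous
    exact h.const_smul c)⟩

theorem hasSum_op_iff {ι : Type*} {T : ι → Op} {S : Op} :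
    HasSum T S ↔ ∀ v, HasSum (fun i => T i v) (S v) := by
  have h : HasSum T S ↔ HasSum (fun i => (T i : Fock → Fock)) (S : Fock → Fock) := by
    unfold HasSum
    rw [isInducing_coe.tendsto_nhds_iff]
    refine Filter.tendsto_congr fun s => ?_
    ext v
    simp
  rw [h, Pi.hasSum]

theorem hasSum_opSum {ι : Type} {T : ι → Op} (h : PointwiseFinite T) : HasSum T (opSum T) := by
  refine hasSum_op_iff.2 fun v => ?_
  rw [opSum_apply h]
  rw [← tsum_eq_finsum (L := .unconditional ι) (h v)]
  exact (summable_of_hasFiniteSupport (h v)).hasSum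

theorem PointwiseFinite.summable {ι : Type} {T : ι → Op} (h : PointwiseFinite T) : Summable T :=
  (hasSum_opSum h).summable

theorem pointwiseFinite_of_summable {ι : Type} {T : ι → Op} (h : Summable T) :
    PointwiseFinite T := fun v => by
  have h1 := (hasSum_op_iff.1 h.hasSum v).summable.tendsto_cofinite_zero
  rw [nhds_discrete, Filter.tendsto_pure] at h1
  exact h1

theorem opSum_eq_of_hasSum {ι : Type} {T : ι → Op} {S : Op} (h : HasSum T S) : opSum T = S :=
  (hasSum_opSum (pointwiseFinite_of_summable h.summable)).unique h

theorem PointwiseFinite.of_forall {ι κ : Type} {T : ι → Op} {U : κ → Op} (hU : PointwiseFinite U)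
    (h : ∀ v, ∃ f : κ → Finset ι, ∀ i, T i v ≠ 0 → ∃ j, U j v ≠ 0 ∧ i ∈ f j) :
    PointwiseFinite T := fun v => by
  obtain ⟨f, hf⟩ := h v
  refine Set.Finite.subset ((hU v).biUnion fun j _ => (f j).finite_toSet) fun i hi => ?_
  obtain ⟨j, hj, hij⟩ := hf i hi
  exact Set.mem_biUnion hj hij

theorem hasSum_mul_left {ι : Type} {T : ι → Op} {S : Op} (A : Op) (h : HasSum T S) :
    HasSum (fun i => A * T i) (A * S) :=
  hasSum_op_iff.2 fun v =>
    (hasSum_op_iff.1 h v).map (A : Fock →+ Fock) continuous_of_discreteTopology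

theorem hasSum_mul_right {ι : Type} {T : ι → Op} {S : Op} (A : Op) (h : HasSum T S) :
    HasSum (fun i => T i * A) (S * A) :=
  hasSum_op_iff.2 fun v => hasSum_op_iff.1 h (A v)

theorem hasSum_mul {ι κ : Type} {T : ι → Op} {U : κ → Op} {S R : Op}
    (hT : HasSum T S) (hU : HasSum U R) :
    HasSum (fun p : ι × κ => T p.1 * U p.2) (S * R) := by
  have hs : PointwiseFinite fun p : ι × κ => T p.1 * U p.2 := fun v => by
    refine Set.Finite.subset ((pointwiseFinite_of_summable hU.summable v).biUnion fun j _ =>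
      (pointwiseFinite_of_summable hT.summable (U j v)).image fun i => (i, j)) ?_
    rintro ⟨i, j⟩ hij
    have hij' : T i (U j v) ≠ 0 := hij
    refine Set.mem_biUnion (x := j) (fun h0 => hij' ?_) ⟨i, hij', rfl⟩
    rw [h0, map_zero]
  have h1 := (Equiv.prodComm κ ι).hasSum_iff.2 (hasSum_opSum hs)
  have h2 := h1.prod_fiberwise fun j => hasSum_mul_right (U j) hT
  rw [← (h2.unique (hasSum_mul_left S hU))]
  exact hasSum_opSum hs

theorem hasSum_of_injective {ι κ α : Type*} [AddCommMonoid α] [TopologicalSpace α] {g : ι → κ}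
    (hg : Function.Injective g) {T : κ → α} {U : ι → α} {S : α} (hT : ∀ j, (∀ i, g i ≠ j) → T j = 0)
    (h : ∀ i, T (g i) = U i) : HasSum T S ↔ HasSum U S := by
  rw [← hg.hasSum_iff (f := T) fun j hj => hT j fun i hi => hj ⟨i, hi⟩]
  exact iff_of_eq (congrArg (HasSum · S) (funext h))

/-- Used for contraction terms: the operator depends on one surviving index, and the contracted
index only contributes a finite scalar sum. -/
theorem hasSum_sum_smul {κ : Type} {U : κ → Op} (hU : PointwiseFinite U) (F : κ → Finset ℤ)
    (g : ℤ → κ → ℂ) :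
    ∃ S, HasSum (fun p : ℤ × κ => if p.1 ∈ F p.2 then g p.1 p.2 • U p.2 else 0) S ∧
      HasSum (fun y => (∑ t ∈ F y, g t y) • U y) S := by
  classical
  have hs : PointwiseFinite
      fun p : ℤ × κ => if p.1 ∈ F p.2 then g p.1 p.2 • U p.2 else 0 := by
    refine PointwiseFinite.of_forall hU fun v => ⟨fun y => (F y).image fun t => (t, y), ?_⟩
    rintro ⟨t, y⟩ h
    dsimp only at h
    split_ifs at h with ht
    · refine ⟨y, fun h0 => h ?_, Finset.mem_image.2 ⟨t, ht, rfl⟩⟩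
      rw [LinearMap.smul_apply, h0, smul_zero]
    · exact absurd rfl h
  refine ⟨_, hasSum_opSum hs, ?_⟩
  refine ((Equiv.prodComm κ ℤ).hasSum_iff.2 (hasSum_opSum hs)).prod_fiberwise fun y => ?_
  rw [Finset.sum_smul]
  have h := hasSum_sum_of_ne_finset_zero (L := .unconditional ℤ) (s := F y)
    (f := fun t => if t ∈ F y then g t y • U y else 0) fun t ht => if_neg ht
  rw [Finset.sum_congr rfl fun t ht => if_pos ht] at h
  exact h

/-! ### Canonical anticommutation relations -/

theorem create_mul_create (i j : ℕ ⊕ ℕ) : create i * create j = -(create j * create i) := by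
  rw [eq_neg_iff_add_eq_zero]
  refine LinearMap.ext fun v => ?_
  simp only [create, LinearMap.add_apply, Module.End.mul_apply, LinearMap.mulLeft_apply,
    ← mul_assoc, ← add_mul, ExteriorAlgebra.ι_add_mul_swap, zero_mul, LinearMap.zero_apply]

theorem annihilate_mul_annihilate (i j : ℕ ⊕ ℕ) :
    annihilate i * annihilate j = -(annihilate j * annihilate i) :=
  LinearMap.ext fun v => CliffordAlgebra.contractLeft_comm _ _ v

theorem annihilate_mul_create (i j : ℕ ⊕ ℕ) :
    annihilate i * create j + create j * annihilate i = if i = j then 1 else 0 := by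
  refine LinearMap.ext fun v => ?_
  have h := CliffordAlgebra.contractLeft_ι_mul (Q := (0 : QuadraticForm ℂ ((ℕ ⊕ ℕ) →₀ ℂ)))
    (Finsupp.lapply i : ((ℕ ⊕ ℕ) →₀ ℂ) →ₗ[ℂ] ℂ) (Finsupp.single j 1) v
  refine (congrArg (· + create j (annihilate i v)) h).trans ?_
  refine (sub_add_cancel _ _).trans ?_
  rw [Finsupp.lapply_apply, Finsupp.single_apply]
  by_cases hij : j = i
  · simp [hij]
  · simp [hij, Ne.symm hij]

theorem ψ_mul_ψ (i j : ℤ) : ψ i * ψ j = -(ψ j * ψ i) := by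
  rcases i with i | i <;> rcases j with j | j
  · exact annihilate_mul_annihilate _ _
  · exact eq_neg_of_add_eq_zero_left ((annihilate_mul_create _ _).trans (by simp))
  · rw [eq_neg_iff_add_eq_zero, add_comm]
    exact (annihilate_mul_create _ _).trans (by simp)
  · exact create_mul_create _ _

theorem ψs_mul_ψs (i j : ℤ) : ψs i * ψs j = -(ψs j * ψs i) := by
  rcases i with i | i <;> rcases j with j | j
  · exact annihilate_mul_annihilate _ _
  · exact eq_neg_of_add_eq_zero_left ((annihilate_mul_create _ _).trans (by simp))
  · rw [eq_neg_iff_add_eq_zero, add_comm]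
    exact (annihilate_mul_create _ _).trans (by simp)
  · exact create_mul_create _ _

theorem ψ_mul_ψs (i j : ℤ) : ψ i * ψs j + ψs j * ψ i = if i + j = -1 then 1 else 0 := by
  rcases i with i | i <;> rcases j with j | j
  · refine (add_eq_zero_iff_eq_neg.2 (annihilate_mul_annihilate _ _)).trans (if_neg ?_).symm
    simp only [Int.ofNat_eq_natCast]
    omega
  · refine (annihilate_mul_create _ _).trans (if_congr ?_ rfl rfl)
    simp only [Int.ofNat_eq_natCast, Sum.inr.injEq]
    omega
  · rw [add_comm]
    refine (annihilate_mul_create _ _).trans (if_congr ?_ rfl rfl)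
    simp only [Int.ofNat_eq_natCast, Sum.inl.injEq]
    omega
  · refine (add_eq_zero_iff_eq_neg.2 (create_mul_create _ _)).trans (if_neg ?_).symm
    omega

theorem ψ_vac {j : ℤ} (hj : 0 ≤ j) : ψ j vac = 0 := by
  obtain ⟨m, rfl⟩ := Int.eq_ofNat_of_zero_le hj
  exact CliffordAlgebra.contractLeft_one (Q := (0 : QuadraticForm ℂ ((ℕ ⊕ ℕ) →₀ ℂ))) _

theorem ψs_vac {j : ℤ} (hj : 0 ≤ j) : ψs j vac = 0 := by
  obtain ⟨m, rfl⟩ := Int.eq_ofNat_of_zero_le hj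
  exact CliffordAlgebra.contractLeft_one (Q := (0 : QuadraticForm ℂ ((ℕ ⊕ ℕ) →₀ ℂ))) _

/-- The integer numbering a mode: the mode has half-integer index `x.num + 1/2`. -/
def Mode.num : Mode → ℤ
  | Mode.psi j => j
  | Mode.psiStar j => j

theorem hf_neg_iff {j : ℤ} : hf j < 0 ↔ j < 0 := by
  rw [hf]
  constructor
  · intro h
    have : (j : ℚ) < 0 := by linarith
    exact_mod_cast this
  · intro h
    have : (j : ℚ) ≤ -1 := by exact_mod_cast Int.le_sub_one_of_lt h
    linarith

theorem hf_pos_iff {j : ℤ} : 0 < hf j ↔ 0 ≤ j := by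
  have h0 : hf j ≠ 0 := by
    rw [hf]
    intro h
    have : ((2 * j + 1 : ℤ) : ℚ) = 0 := by push_cast; linarith
    have h2 : 2 * j + 1 = 0 := by exact_mod_cast this
    omega
  rw [← not_lt, ← hf_neg_iff, not_lt]
  exact ⟨le_of_lt, fun h => lt_of_le_of_ne h h0.symm⟩

theorem Mode.index_neg_iff (x : Mode) : x.index < 0 ↔ x.num < 0 := by
  cases x <;> exact hf_neg_iff

/-- The anticommutator of two modes, a scalar. -/
def Mode.bracket : Mode → Mode → ℂ
  | Mode.psi _, Mode.psi _ => 0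
  | Mode.psiStar _, Mode.psiStar _ => 0
  | Mode.psi i, Mode.psiStar j => if i + j = -1 then 1 else 0
  | Mode.psiStar j, Mode.psi i => if i + j = -1 then 1 else 0

theorem Mode.op_mul_op (x y : Mode) : x.op * y.op = x.bracket y • 1 - y.op * x.op := by
  rw [eq_sub_iff_add_eq]
  rcases x with i | i <;> rcases y with j | j
  · simp only [op, bracket, zero_smul]
    exact add_eq_zero_iff_eq_neg.2 (ψ_mul_ψ i j)
  · simp only [op, bracket, ite_smul, one_smul, zero_smul]
    exact ψ_mul_ψs i j
  · simp only [op, bracket, ite_smul, one_smul, zero_smul]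
    rw [add_comm]
    exact ψ_mul_ψs j i
  · simp only [op, bracket, zero_smul]
    exact add_eq_zero_iff_eq_neg.2 (ψs_mul_ψs i j)

theorem Mode.bracket_eq_zero {x y : Mode} (h : x.num + y.num ≠ -1) : x.bracket y = 0 := by
  rcases x with i | i <;> rcases y with j | j
  · rfl
  · exact if_neg h
  · exact if_neg fun h' => h ((add_comm _ _).trans h')
  · rfl

/-! ### Vectors killed by all modes of large index -/

/-- `v` is killed by all the modes of number at least `N`. -/
def KilledFrom (N : ℤ) (v : Fock) : Prop := ∀ x : Mode, N ≤ x.num → x.op v = 0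

/-- Only finitely many basis vectors occur in `v`. In the induction, contraction passes a factor `w`
up to sign unless the mode lies in the finite support of `w`. -/
theorem exists_annihilate_eq_zero (v : Fock) :
    ∃ N : ℕ, ∀ m, N ≤ m → annihilate (Sum.inl m) v = 0 ∧ annihilate (Sum.inr m) v = 0 := by
  induction v using CliffordAlgebra.left_induction with
  | algebraMap r =>
    exact ⟨0, fun m _ => ⟨CliffordAlgebra.contractLeft_algebraMap _ _ r,
      CliffordAlgebra.contractLeft_algebraMap _ _ r⟩⟩
  | add x y hx hy =>
    obtain ⟨N, hN⟩ := hx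
    obtain ⟨M, hM⟩ := hy
    refine ⟨max N M, fun m hm => ?_⟩
    have h1 := hN m ((le_max_left _ _).trans hm)
    have h2 := hM m ((le_max_right _ _).trans hm)
    simp [h1, h2]
  | ι_mul x w hx =>
    obtain ⟨N, hN⟩ := hx
    have key : ∀ i : ℕ ⊕ ℕ, i ∉ w.support → annihilate i x = 0 →
        annihilate i (CliffordAlgebra.ι (0 : QuadraticForm ℂ ((ℕ ⊕ ℕ) →₀ ℂ)) w * x) = 0 := by
      intro i hi h0
      refine (CliffordAlgebra.contractLeft_ι_mul _ _ _).trans ?_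
      rw [Finsupp.lapply_apply, Finsupp.notMem_support_iff.1 hi, zero_smul, zero_sub, neg_eq_zero]
      exact (congrArg _ h0).trans (mul_zero _)
    obtain ⟨M, hM⟩ : ∃ M : ℕ, ∀ i ∈ w.support, Sum.elim id id i < M := by
      refine ⟨w.support.sup (Sum.elim id id) + 1, fun i hi => ?_⟩
      exact Nat.lt_succ_of_le (Finset.le_sup (f := Sum.elim id id) hi)
    refine ⟨max N M, fun m hm => ?_⟩
    have h1 := hN m ((le_max_left _ _).trans hm)
    have h2 : M ≤ m := (le_max_right _ _).trans hm
    exact ⟨key _ (fun h => absurd (hM _ h) (not_lt.2 h2)) h1.1,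
      key _ (fun h => absurd (hM _ h) (not_lt.2 h2)) h1.2⟩

theorem exists_killedFrom (v : Fock) : ∃ N : ℤ, 0 ≤ N ∧ KilledFrom N v := by
  obtain ⟨N, hN⟩ := exists_annihilate_eq_zero v
  refine ⟨N, Int.natCast_nonneg N, fun x hx => ?_⟩
  rcases x with j | j
  · obtain ⟨m, rfl⟩ := Int.eq_ofNat_of_zero_le ((Int.natCast_nonneg N).trans hx)
    exact (hN m (Int.ofNat_le.1 hx)).2
  · obtain ⟨m, rfl⟩ := Int.eq_ofNat_of_zero_le ((Int.natCast_nonneg N).trans hx)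
    exact (hN m (Int.ofNat_le.1 hx)).1

theorem KilledFrom.op {N : ℤ} {v : Fock} (hN : 0 ≤ N) (h : KilledFrom N v) {x : Mode}
    (hx : 0 ≤ x.num) : KilledFrom N (x.op v) := fun y hy => by
  have h1 := LinearMap.congr_fun (Mode.op_mul_op y x) v
  rw [Mode.bracket_eq_zero (by omega), zero_smul, zero_sub] at h1
  refine h1.trans ?_
  rw [LinearMap.neg_apply, Module.End.mul_apply, h y hy, map_zero, neg_zero]

/-- A mode of number at least `N` annihilates, hence stands to the right of all creators; the
annihilators acting before it preserve the property by `KilledFrom.op`. -/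
theorem KilledFrom.normalOrder {N : ℤ} (hN : 0 ≤ N) {L : List Mode} :
    ∀ {v : Fock}, KilledFrom N v → (∃ x ∈ L, N ≤ x.num) → normalOrder L v = 0 := by
  induction L with
  | nil => simp
  | cons y L ih =>
    rintro v hv ⟨x, hx, hxN⟩
    rw [CSFermion.normalOrder]
    split_ifs with hy
    · rw [Mode.index_neg_iff] at hy
      rcases List.mem_cons.1 hx with rfl | hx
      · omega
      · rw [Module.End.mul_apply, ih hv ⟨x, hx, hxN⟩, map_zero]
    · rw [Mode.index_neg_iff, not_lt] at hy
      rw [LinearMap.smul_apply, Module.End.mul_apply]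
      rcases List.mem_cons.1 hx with rfl | hx
      · rw [hv x hxN, map_zero, smul_zero]
      · rw [ih (hv.op hN hy) ⟨x, hx, hxN⟩, smul_zero]

theorem KilledFrom.no2 {N : ℤ} (hN : 0 ≤ N) {v : Fock} (hv : KilledFrom N v) {r s : ℤ}
    (h : N ≤ r ∨ N ≤ s) : no2 r s v = 0 :=
  hv.normalOrder hN (by simpa [Mode.num] using h)

theorem KilledFrom.no4 {N : ℤ} (hN : 0 ≤ N) {v : Fock} (hv : KilledFrom N v) {r s k l : ℤ}
    (h : N ≤ r ∨ N ≤ s ∨ N ≤ k ∨ N ≤ l) : no4 r s k l v = 0 :=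
  hv.normalOrder hN (by simpa [Mode.num] using h)

/-! ### Wick's theorem -/

theorem normalOrder_cons_neg {x : Mode} (hx : x.num < 0) (L : List Mode) :
    normalOrder (x :: L) = x.op * normalOrder L := by
  rw [normalOrder, if_pos ((Mode.index_neg_iff x).2 hx)]

theorem normalOrder_cons_nonneg {x : Mode} (hx : 0 ≤ x.num) (L : List Mode) :
    normalOrder (x :: L) = ((-1 : ℂ) ^ L.length) • (normalOrder L * x.op) := by
  rw [normalOrder, if_neg (mt (Mode.index_neg_iff x).1 (not_lt.2 hx))]

theorem normalOrder_cons_congr {z : Mode} {A B : List Mode} (hl : A.length = B.length)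
    (h : normalOrder A = -normalOrder B) : normalOrder (z :: A) = -normalOrder (z :: B) := by
  rcases lt_or_ge z.num 0 with hz | hz
  · rw [normalOrder_cons_neg hz, normalOrder_cons_neg hz, h, mul_neg]
  · rw [normalOrder_cons_nonneg hz, normalOrder_cons_nonneg hz, h, hl, neg_mul, smul_neg]

/-- For a creator and an annihilator this is the sign rule of the definition; two modes of the same
type have zero bracket and anticommute as operators. -/
theorem normalOrder_swap (x y : Mode) (L : List Mode) :
    normalOrder (x :: y :: L) = -normalOrder (y :: x :: L) := by
  rcases lt_or_ge x.num 0 with hx | hx <;> rcases lt_or_ge y.num 0 with hy | hy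
  · simp only [normalOrder_cons_neg hx, normalOrder_cons_neg hy, ← mul_assoc]
    rw [Mode.op_mul_op, Mode.bracket_eq_zero (by omega)]
    simp
  · simp only [normalOrder_cons_neg hx, normalOrder_cons_nonneg hy, List.length_cons, pow_succ,
      mul_smul_comm, mul_assoc, mul_neg, neg_neg, mul_one, neg_smul]
  · simp only [normalOrder_cons_neg hy, normalOrder_cons_nonneg hx, List.length_cons, pow_succ,
      mul_smul_comm, mul_assoc, mul_neg, mul_one, neg_smul]
  · simp only [normalOrder_cons_nonneg hx, normalOrder_cons_nonneg hy, List.length_cons,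
      smul_mul_assoc, mul_assoc]
    rw [Mode.op_mul_op y x, Mode.bracket_eq_zero (by omega)]
    simp

theorem no4_swap_stars (r s k l : ℤ) : no4 r l k s = -no4 r s k l := by
  have h1 : normalOrder [.psi r, .psiStar l, .psi k, .psiStar s] =
      -normalOrder [.psi r, .psi k, .psiStar l, .psiStar s] :=
    normalOrder_cons_congr rfl (normalOrder_swap _ _ _)
  have h2 : normalOrder [.psi r, .psi k, .psiStar l, .psiStar s] =
      -normalOrder [.psi r, .psi k, .psiStar s, .psiStar l] :=
    normalOrder_cons_congr rfl (normalOrder_cons_congr rfl (normalOrder_swap _ _ _))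
  have h3 : normalOrder [.psi r, .psi k, .psiStar s, .psiStar l] =
      -normalOrder [.psi r, .psiStar s, .psi k, .psiStar l] :=
    normalOrder_cons_congr rfl (normalOrder_swap _ _ _)
  rw [no4, h1, h2, h3, neg_neg, no4]

theorem no4_swap_pairs (r s k l : ℤ) : no4 k l r s = no4 r s k l := by
  have h1 : normalOrder [.psi k, .psiStar s, .psi r, .psiStar l] =
      -normalOrder [.psi k, .psi r, .psiStar s, .psiStar l] :=
    normalOrder_cons_congr rfl (normalOrder_swap _ _ _)
  have h2 : normalOrder [.psi r, .psi k, .psiStar s, .psiStar l] =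
      -normalOrder [.psi r, .psiStar s, .psi k, .psiStar l] :=
    normalOrder_cons_congr rfl (normalOrder_swap _ _ _)
  rw [no4_swap_stars k s r l, no4, h1, normalOrder_swap, h2, neg_neg, neg_neg, no4]

theorem no2_eq (r s : ℤ) :
    no2 r s = ψ r * ψs s - (if 0 ≤ r ∧ r + s = -1 then 1 else 0 : ℂ) • 1 := by
  rw [no2]
  rcases lt_or_ge r 0 with hr | hr
  · rw [normalOrder_cons_neg (x := .psi r) hr, if_neg (by omega)]
    simp [normalOrder, Mode.op]
  · rw [normalOrder_cons_nonneg (x := .psi r) hr]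
    have h := Mode.op_mul_op (.psi r) (.psiStar s)
    simp only [Mode.op, Mode.bracket] at h
    rw [h]
    simp [normalOrder, Mode.op, hr]

theorem normalOrder_three (s k l : ℤ) : normalOrder [.psiStar s, .psi k, .psiStar l] =
    ψs s * no2 k l - (if 0 ≤ s ∧ k + s = -1 then 1 else 0 : ℂ) • ψs l := by
  rcases lt_or_ge s 0 with hs | hs
  · rw [normalOrder_cons_neg (x := .psiStar s) hs, if_neg (by omega), zero_smul, sub_zero]
    rfl
  · rw [normalOrder_cons_nonneg (x := .psiStar s) hs]
    have h1 := Mode.op_mul_op (.psi k) (.psiStar s)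
    simp only [Mode.op, Mode.bracket] at h1
    have h : no2 k l * ψs s = ψs s * no2 k l - (if k + s = -1 then 1 else 0 : ℂ) • ψs l := by
      rw [no2_eq, sub_mul, mul_sub, mul_assoc, ψs_mul_ψs l s, mul_neg, ← mul_assoc, h1]
      simp only [sub_mul, smul_mul_assoc, one_mul, mul_smul_comm, mul_one, mul_assoc]
      abel
    simp only [List.length_cons, List.length_nil, zero_add, Nat.reduceAdd, even_two, Even.neg_pow,
      one_pow, one_smul, hs, true_and]
    exact h

theorem ψs_mul_ψ (i j : ℤ) : ψs j * ψ i = (if i + j = -1 then 1 else 0 : ℂ) • 1 - ψ i * ψs j := by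
  have h := Mode.op_mul_op (.psiStar j) (.psi i)
  simpa only [Mode.op, Mode.bracket] using h

theorem no2_eq' (k s : ℤ) :
    no2 k s = (if 0 ≤ s ∧ k + s = -1 then 1 else 0 : ℂ) • 1 - ψs s * ψ k := by
  have e : (if k + s = -1 then 1 else 0 : ℂ) =
      (if 0 ≤ s ∧ k + s = -1 then 1 else 0) + if 0 ≤ k ∧ k + s = -1 then 1 else 0 := by
    split_ifs <;> first | omega | simp
  rw [no2_eq, ψs_mul_ψ, e]
  module

theorem no2_mul_ψ (k l r : ℤ) :
    no2 k l * ψ r = (if r + l = -1 then 1 else 0 : ℂ) • ψ k + ψ r * no2 k l := by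
  rw [no2_eq, sub_mul, mul_sub, mul_assoc, ψs_mul_ψ, mul_sub, ← mul_assoc, ψ_mul_ψ k r]
  simp only [smul_mul_assoc, mul_smul_comm, one_mul, mul_one, neg_mul, mul_assoc]
  abel

theorem no4_eq (r s k l : ℤ) : no4 r s k l = ψ r * normalOrder [.psiStar s, .psi k, .psiStar l]
    - (if 0 ≤ r ∧ r + s = -1 then 1 else 0 : ℂ) • no2 k l
    + (if 0 ≤ r ∧ r + l = -1 then 1 else 0 : ℂ) • no2 k s := by
  rw [no4]
  rcases lt_or_ge r 0 with hr | hr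
  · rw [normalOrder_cons_neg (x := .psi r) hr, if_neg (by omega), if_neg (by omega), zero_smul,
      zero_smul, sub_zero, add_zero]
    rfl
  · rw [normalOrder_cons_nonneg (x := .psi r) hr]
    have h : normalOrder [.psiStar s, .psi k, .psiStar l] * ψ r =
        (if r + s = -1 then 1 else 0 : ℂ) • no2 k l - (if r + l = -1 then 1 else 0 : ℂ) • no2 k s
        - ψ r * normalOrder [.psiStar s, .psi k, .psiStar l] := by
      rw [normalOrder_three, sub_mul, mul_assoc, no2_mul_ψ, mul_add, ← mul_assoc (ψs s), ψs_mul_ψ r s,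
        smul_mul_assoc, ψs_mul_ψ r l, no2_eq' k s]
      simp only [smul_mul_assoc, mul_smul_comm, one_mul, sub_mul, mul_sub, mul_assoc]
      module
    simp only [List.length_cons, List.length_nil, Mode.op, h, hr, true_and]
    module

/-- Wick's theorem: `ψ*_s` contracts with `ψ_k` when `s > 0`, and `ψ_r` with `ψ*_l` when `r > 0`. -/
theorem no2_mul_no2 (r s k l : ℤ) : no2 r s * no2 k l = no4 r s k l
    + (if 0 ≤ s ∧ k + s = -1 then 1 else 0 : ℂ) • no2 r l
    - (if 0 ≤ r ∧ r + l = -1 then 1 else 0 : ℂ) • no2 k s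
    + ((if 0 ≤ s ∧ k + s = -1 then 1 else 0) * (if 0 ≤ r ∧ r + l = -1 then 1 else 0) : ℂ) • 1 := by
  rw [no4_eq, normalOrder_three, no2_eq r s, no2_eq r l]
  simp only [smul_mul_assoc, mul_smul_comm, one_mul, sub_mul, mul_sub, mul_assoc]
  module

/-- The normally ordered quadratic monomials of total index `n` form a pointwise finite family. -/
theorem pointwiseFinite_no2 (n : ℤ) : PointwiseFinite fun y : ℤ => no2 (n - 1 - y) y := fun v => by
  obtain ⟨N, hN, hv⟩ := exists_killedFrom v
  refine (Set.finite_Icc (n - 1 - N) N).subset fun y hy => ?_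
  by_contra h
  rw [Set.mem_Icc] at h
  exact hy (hv.no2 hN (by omega))

theorem PointwiseFinite.smul {ι : Type} {T : ι → Op} (h : PointwiseFinite T) (c : ι → ℂ) :
    PointwiseFinite fun i => c i • T i := fun v =>
  (h v).subset fun i hi h0 => hi (by rw [LinearMap.smul_apply, h0, smul_zero])

theorem PointwiseFinite.comp_injective {ι κ : Type} {T : κ → Op} (h : PointwiseFinite T)
    {g : ι → κ} (hg : Function.Injective g) : PointwiseFinite fun i => T (g i) := fun v =>
  (h v).preimage hg.injOn

/-- The normally ordered quartic monomials of total index `n` form a pointwise finite family. -/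
theorem pointwiseFinite_no4 (n : ℤ) : PointwiseFinite fun p : ℤ × ℤ × ℤ =>
    no4 (n - p.1 - 1 - p.2.1) p.2.1 (p.1 - 1 - p.2.2) p.2.2 := fun v => by
  obtain ⟨N, hN, hv⟩ := exists_killedFrom v
  -- All four numbers must be below `N` and their sum is fixed, so each is also bounded below.
  refine ((Set.finite_Icc (n - 2 * N) (2 * N)).prod ((Set.finite_Icc (n - 3 * N) N).prod
    (Set.finite_Icc (n - 3 * N) N))).subset ?_
  rintro ⟨b, i, j⟩ h
  by_contra h'
  simp only [Set.mem_prod, Set.mem_Icc] at h'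
  exact h (hv.no4 hN (by dsimp only; omega))

theorem aTildeTerm_eq {n q r : ℤ} : aTildeTerm n (q, r) = if q + r + 1 = n then no2 q r else 0 := by
  rw [aTildeTerm]
  refine if_congr ?_ rfl rfl
  simp only [hf]
  rw [← Int.cast_inj (α := ℚ)]
  push_cast
  constructor <;> intro h <;> linarith

theorem pointwiseFinite_aTildeTerm (n : ℤ) : PointwiseFinite (aTildeTerm n) := by
  refine PointwiseFinite.of_forall (pointwiseFinite_no2 n) fun v =>
    ⟨fun y => {(n - 1 - y, y)}, ?_⟩
  rintro ⟨q, r⟩ h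
  rw [aTildeTerm_eq] at h
  split_ifs at h with hn
  · obtain rfl : q = n - 1 - r := by omega
    exact ⟨r, h, Finset.mem_singleton_self _⟩
  · exact absurd rfl h

theorem hasSum_aTilde (n : ℤ) : HasSum (fun y : ℤ => no2 (n - 1 - y) y) (aTilde n) := by
  refine (hasSum_of_injective (g := fun y : ℤ => (n - 1 - y, y)) (T := aTildeTerm n)
    (fun a b h => (Prod.ext_iff.1 h).2) ?_ fun y => ?_).1
    (hasSum_opSum (pointwiseFinite_aTildeTerm n))
  · rintro ⟨q, r⟩ h
    rw [aTildeTerm_eq, if_neg]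
    intro hn
    exact h r (by ext <;> dsimp only; omega)
  · rw [aTildeTerm_eq, if_pos (by ring)]

theorem KilledFrom.aTilde {N : ℤ} (hN : 0 ≤ N) {v : Fock} (hv : KilledFrom N v) {n : ℤ}
    (hn : 2 * N ≤ n) : aTilde n v = 0 := by
  refine (hasSum_op_iff.1 (hasSum_aTilde n) v).unique ?_
  convert hasSum_zero with y
  -- The two numbers add up to `n - 1 ≥ 2N - 1`, so they cannot both be below `N`.
  exact hv.no2 hN (by omega)

theorem killedFrom_vac : KilledFrom 0 vac := fun x hx => by
  cases x
  · exact ψ_vac hx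
  · exact ψs_vac hx

theorem aTilde_vac {n : ℤ} (hn : 0 ≤ n) : aTilde n vac = 0 :=
  killedFrom_vac.aTilde le_rfl (by omega)

/-! ### The Heisenberg algebra -/

theorem no2_commutator (r s k l : ℤ) : no2 r s * no2 k l - no2 k l * no2 r s =
    (if k + s = -1 then 1 else 0 : ℂ) • no2 r l - (if r + l = -1 then 1 else 0 : ℂ) • no2 k s
    + (if k + s = -1 ∧ r + l = -1 then
        (if 0 ≤ s ∧ 0 ≤ r then 1 else 0) - (if s < 0 ∧ r < 0 then 1 else 0) else 0 : ℂ) • 1 := by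
  rw [no2_mul_no2 r s k l, no2_mul_no2 k l r s, no4_swap_pairs r s k l]
  have e1 : (if 0 ≤ s ∧ k + s = -1 then 1 else 0 : ℂ) =
      (if k + s = -1 then 1 else 0) - if 0 ≤ k ∧ k + s = -1 then 1 else 0 := by
    split_ifs <;> first | omega | simp
  have e2 : (if 0 ≤ r ∧ r + l = -1 then 1 else 0 : ℂ) =
      (if r + l = -1 then 1 else 0) - if 0 ≤ l ∧ r + l = -1 then 1 else 0 := by
    split_ifs <;> first | omega | simp
  have e3 : (if k + s = -1 ∧ r + l = -1 then
        (if 0 ≤ s ∧ 0 ≤ r then 1 else 0) - (if s < 0 ∧ r < 0 then 1 else 0) else 0 : ℂ) =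
      (if 0 ≤ s ∧ k + s = -1 then 1 else 0) * (if 0 ≤ r ∧ r + l = -1 then 1 else 0) -
      (if 0 ≤ l ∧ r + l = -1 then 1 else 0) * (if 0 ≤ k ∧ k + s = -1 then 1 else 0) := by
    split_ifs <;> first | omega | simp
  rw [e3, e1, e2]
  module

theorem hasSum_Ico_const (a b : ℤ) (T : Op) :
    HasSum (fun i : ℤ => if a ≤ i ∧ i < b then T else 0) (((b - a).toNat : ℂ) • T) := by
  have h := hasSum_sum_of_ne_finset_zero (L := .unconditional ℤ) (s := Finset.Ico a b)
    (f := fun i : ℤ => if a ≤ i ∧ i < b then T else 0)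
    fun i hi => if_neg (mt Finset.mem_Ico.2 hi)
  rwa [Finset.sum_congr rfl fun i hi => if_pos (Finset.mem_Ico.1 hi), Finset.sum_const,
    Int.card_Ico, ← Nat.cast_smul_eq_nsmul ℂ] at h

/-- Thanks to normal ordering, the two bilinear parts of the commutator converge separately, both to
`ã_{m+n}`, and cancel. The double contractions remain. -/
theorem aTilde_commutator (m n : ℤ) : aTilde m * aTilde n - aTilde n * aTilde m =
    if m + n = 0 then (m : ℂ) • (1 : Op) else 0 := by
  have h1 := hasSum_mul (hasSum_aTilde m) (hasSum_aTilde n)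
  have h2 := (Equiv.prodComm ℤ ℤ).hasSum_iff.2 (hasSum_mul (hasSum_aTilde n) (hasSum_aTilde m))
  have h3 : HasSum (fun p : ℤ × ℤ => (if n - 1 - p.2 + p.1 = -1 then 1 else 0 : ℂ) •
      no2 (m - 1 - p.1) p.2) (aTilde (m + n)) := by
    refine (hasSum_of_injective (g := fun j : ℤ => (j - n, j))
      (fun a b h => (Prod.ext_iff.1 h).2) ?_ fun j => ?_).2 (hasSum_aTilde (m + n))
    · rintro ⟨i, j⟩ h
      dsimp only
      rw [if_neg, zero_smul]
      exact fun hn => h j (by ext <;> dsimp only; omega)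
    · dsimp only
      rw [if_pos (by ring), one_smul]
      congr 1
      ring
  have h4 : HasSum (fun p : ℤ × ℤ => (if m - 1 - p.1 + p.2 = -1 then 1 else 0 : ℂ) •
      no2 (n - 1 - p.2) p.1) (aTilde (m + n)) := by
    refine (hasSum_of_injective (g := fun i : ℤ => (i, i - m))
      (fun a b h => (Prod.ext_iff.1 h).1) ?_ fun j => ?_).2 (hasSum_aTilde (m + n))
    · rintro ⟨i, j⟩ h
      dsimp only
      rw [if_neg, zero_smul]
      exact fun hn => h i (by ext <;> dsimp only; omega)
    · dsimp only
      rw [if_pos (by ring), one_smul]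
      congr 1
      ring
  have h5 : HasSum (fun p : ℤ × ℤ => (if n - 1 - p.2 + p.1 = -1 ∧ m - 1 - p.1 + p.2 = -1 then
        (if 0 ≤ p.1 ∧ 0 ≤ m - 1 - p.1 then 1 else 0) - (if p.1 < 0 ∧ m - 1 - p.1 < 0 then 1 else 0)
        else 0 : ℂ) • (1 : Op)) (if m + n = 0 then (m : ℂ) • (1 : Op) else 0) := by
    split_ifs with hmn
    -- The central term counts `0 ≤ i < m` with sign `+` and `m ≤ i < 0` with sign `-`; one range is
    -- empty, and the signed count is `m`.
    · have h6 := (hasSum_Ico_const 0 m 1).sub (hasSum_Ico_const m 0 1)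
      rw [← sub_smul] at h6
      have e : (((m - 0).toNat : ℂ) - ((0 - m).toNat : ℂ)) = m := by
        have := Int.toNat_sub_toNat_neg m
        rw [sub_zero, zero_sub]
        exact_mod_cast congrArg (Int.cast (R := ℂ)) this
      rw [e] at h6
      refine (hasSum_of_injective (g := fun i : ℤ => (i, n + i))
        (fun a b h => (Prod.ext_iff.1 h).1) ?_ fun i => ?_).2 h6
      · rintro ⟨i, j⟩ h
        dsimp only
        rw [if_neg, zero_smul]
        exact fun hn => h i (by ext <;> dsimp only; omega)
      · dsimp only
        rw [if_pos (by omega), sub_smul, ite_smul, ite_smul, one_smul, zero_smul]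
        congr 1 <;> refine if_congr ?_ rfl rfl <;> omega
    · convert hasSum_zero with p
      rw [if_neg (by omega), zero_smul]
  refine (h1.sub h2).unique ?_
  have h6 := (h3.sub h4).add h5
  rw [sub_self, zero_add] at h6
  convert h6 using 2 with p
  exact no2_commutator _ _ _ _

theorem aTilde_mul_comm {m n : ℤ} (h : m + n ≠ 0) : aTilde m * aTilde n = aTilde n * aTilde m := by
  rw [← sub_eq_zero, aTilde_commutator, if_neg h]

/-! ### Sums of products of two currents -/

/-- Fermionic form of `∑_{b ≥ c} ∑ f(b,s,l) :ψ_r ψ*_s: :ψ_k ψ*_l:`, where `r + s = n - b` and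
`k + l = b`. -/
theorem hasSum_no2_mul_no2 {n c : ℤ} (hc : n ≠ 0 ∨ 0 < c) (f : ℤ → ℤ → ℤ → ℂ) :
    ∃ X Y Z : Op,
      HasSum (fun p : ℤ × ℤ × ℤ => if c ≤ p.1 then f p.1 p.2.1 p.2.2 •
        (no2 (n - p.1 - 1 - p.2.1) p.2.1 * no2 (p.1 - 1 - p.2.2) p.2.2) else 0) (X + Y - Z) ∧
      HasSum (fun p : ℤ × ℤ × ℤ => if c ≤ p.1 then f p.1 p.2.1 p.2.2 •
        no4 (n - p.1 - 1 - p.2.1) p.2.1 (p.1 - 1 - p.2.2) p.2.2 else 0) X ∧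
      HasSum (fun y => (∑ i ∈ Finset.Ico 0 (y - c + 1), f (y - i) i y) • no2 (n - 1 - y) y) Y ∧
      HasSum (fun y => (∑ b ∈ Finset.Ico c (n - y), f b y (b + y - n)) • no2 (n - 1 - y) y) Z := by
  have hX : Summable (fun p : ℤ × ℤ × ℤ => if c ≤ p.1 then f p.1 p.2.1 p.2.2 •
        no4 (n - p.1 - 1 - p.2.1) p.2.1 (p.1 - 1 - p.2.2) p.2.2 else 0) := by
    refine PointwiseFinite.summable ?_
    simpa only [ite_smul, zero_smul] using
      (pointwiseFinite_no4 n).smul fun p => if c ≤ p.1 then f p.1 p.2.1 p.2.2 else 0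
  obtain ⟨Y, hY1, hY2⟩ := hasSum_sum_smul (pointwiseFinite_no2 n)
    (fun y => Finset.Ico 0 (y - c + 1)) fun i y => f (y - i) i y
  obtain ⟨Z, hZ1, hZ2⟩ := hasSum_sum_smul (pointwiseFinite_no2 n)
    (fun y => Finset.Ico c (n - y)) fun b y => f b y (b + y - n)
  refine ⟨_, Y, Z, ?_, hX.hasSum, hY2, hZ2⟩
  have hY : HasSum (fun p : ℤ × ℤ × ℤ => if c ≤ p.1 ∧ 0 ≤ p.2.1 ∧ p.2.2 = p.1 + p.2.1 then
      f p.1 p.2.1 p.2.2 • no2 (n - 1 - p.2.2) p.2.2 else 0) Y := by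
    refine (hasSum_of_injective (g := fun q : ℤ × ℤ => (q.2 - q.1, q.1, q.2))
      (fun a b h => ?_) ?_ ?_).2 hY1
    · simp only [Prod.mk.injEq] at h
      exact Prod.ext h.2.1 h.2.2
    · rintro ⟨b, i, j⟩ h
      refine if_neg fun hn => h (i, j) ?_
      ext <;> dsimp only at hn ⊢
      omega
    · rintro ⟨i, y⟩
      refine if_congr ?_ rfl rfl
      rw [Finset.mem_Ico]
      dsimp only
      omega
  have hZ : HasSum (fun p : ℤ × ℤ × ℤ => if c ≤ p.1 ∧ p.1 < n - p.2.1 ∧ p.2.2 = p.1 + p.2.1 - n then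
      f p.1 p.2.1 p.2.2 • no2 (n - 1 - p.2.1) p.2.1 else 0) Z := by
    refine (hasSum_of_injective (g := fun q : ℤ × ℤ => (q.1, q.2, q.1 + q.2 - n))
      (fun a b h => ?_) ?_ ?_).2 hZ1
    · simp only [Prod.mk.injEq] at h
      exact Prod.ext h.1 h.2.1
    · rintro ⟨b, i, j⟩ h
      refine if_neg fun hn => h (b, i) ?_
      ext <;> dsimp only at hn ⊢
      omega
    · rintro ⟨b, y⟩
      refine if_congr ?_ rfl rfl
      rw [Finset.mem_Ico]
      dsimp only
      omega
  refine (iff_of_eq (congrArg (HasSum · _) (funext ?_))).2 ((hX.hasSum.add hY).sub hZ)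
  rintro ⟨b, i, j⟩
  dsimp only
  by_cases hb : c ≤ b
  · rw [if_pos hb, if_pos hb, no2_mul_no2]
    -- A double contraction forces `n = 0` and `b < 0`, which `hc` and `c ≤ b` exclude.
    have e : ((if 0 ≤ i ∧ b - 1 - j + i = -1 then 1 else 0) *
        (if 0 ≤ n - b - 1 - i ∧ n - b - 1 - i + j = -1 then 1 else 0) : ℂ) = 0 := by
      split_ifs <;> first | omega | simp
    rw [e, zero_smul, add_zero, smul_sub, smul_add]
    congr 2
    · by_cases h : 0 ≤ i ∧ b - 1 - j + i = -1
      · rw [if_pos h, if_pos (by omega), one_smul]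
        congr 2
        omega
      · rw [if_neg h, if_neg (by omega), zero_smul, smul_zero]
    · by_cases h : 0 ≤ n - b - 1 - i ∧ n - b - 1 - i + j = -1
      · rw [if_pos h, if_pos (by omega), one_smul]
        congr 2
        omega
      · rw [if_neg h, if_neg (by omega), zero_smul, smul_zero]
  · rw [if_neg hb, if_neg hb, if_neg (fun h => hb h.1), if_neg (fun h => hb h.1), add_zero, sub_zero]

/-- A quartic sum vanishes if its coefficient is symmetric in the two `ψ*` indices. -/
theorem eq_zero_of_hasSum_no4 {n : ℤ} {f : ℤ → ℤ → ℤ → ℂ} {X : Op}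
    (hf : ∀ b i j, f (b + i - j) j i = f b i j)
    (h : HasSum (fun p : ℤ × ℤ × ℤ => f p.1 p.2.1 p.2.2 •
      no4 (n - p.1 - 1 - p.2.1) p.2.1 (p.1 - 1 - p.2.2) p.2.2) X) : X = 0 := by
  -- The involution exchanges `s` and `l` while keeping `r` and `k`; this flips the sign of the
  -- monomial, so the sum equals its own negative.
  have hinv : Function.Involutive
      fun p : ℤ × ℤ × ℤ => (p.1 + p.2.1 - p.2.2, p.2.2, p.2.1) := by
    rintro ⟨b, i, j⟩
    simp
  have h1 : HasSum (fun p : ℤ × ℤ × ℤ => -(f p.1 p.2.1 p.2.2 •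
      no4 (n - p.1 - 1 - p.2.1) p.2.1 (p.1 - 1 - p.2.2) p.2.2)) X := by
    refine (hasSum_of_injective hinv.injective (fun p hp => absurd (hinv p) (hp _)) ?_).2 h
    rintro ⟨b, i, j⟩
    dsimp only
    rw [hf, ← smul_neg, ← no4_swap_stars]
    congr 2 <;> ring
  have h2 := h.unique (by simpa using h1.neg)
  have h3 : X = (1 / 2 : ℂ) • (X - -X) := by module
  rw [h3, ← h2, sub_self, smul_zero]

/-- Exchange of the two pairs in a quartic sum. -/
theorem hasSum_no4_swap_pairs {n : ℤ} {f : ℤ → ℤ → ℤ → ℂ} {X : Op}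
    (h : HasSum (fun p : ℤ × ℤ × ℤ => f p.1 p.2.1 p.2.2 •
      no4 (n - p.1 - 1 - p.2.1) p.2.1 (p.1 - 1 - p.2.2) p.2.2) X) :
    HasSum (fun p : ℤ × ℤ × ℤ => f (n - p.1) p.2.2 p.2.1 •
      no4 (n - p.1 - 1 - p.2.1) p.2.1 (p.1 - 1 - p.2.2) p.2.2) X := by
  have hinv : Function.Involutive fun p : ℤ × ℤ × ℤ => (n - p.1, p.2.2, p.2.1) := by
    rintro ⟨b, i, j⟩
    simp
  refine (hasSum_of_injective hinv.injective (fun p hp => absurd (hinv p) (hp _)) ?_).2 h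
  rintro ⟨b, i, j⟩
  dsimp only
  rw [no4_swap_pairs, sub_sub_cancel]

theorem hasSum_fiber_mul {n : ℤ} {c : ℤ} {f : ℤ → ℤ → ℤ → ℂ} {S : ℤ → Op} {X : Op}
    (hS : ∀ b, HasSum (fun q : ℤ × ℤ => f b q.1 q.2 •
      (no2 (n - b - 1 - q.1) q.1 * no2 (b - 1 - q.2) q.2)) (S b))
    (h : HasSum (fun p : ℤ × ℤ × ℤ => if c ≤ p.1 then f p.1 p.2.1 p.2.2 •
      (no2 (n - p.1 - 1 - p.2.1) p.2.1 * no2 (p.1 - 1 - p.2.2) p.2.2) else 0) X) :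
    HasSum (fun b => if c ≤ b then S b else 0) X := by
  refine h.prod_fiberwise fun b => ?_
  dsimp only
  split_ifs
  · exact hS b
  · exact hasSum_zero

/-- The Sugawara modes `∑_{r+s=n} (s - r) :ψ_r ψ*_s:`. -/
noncomputable def sugawara (n : ℤ) : Op :=
  opSum fun y : ℤ => ((2 * y - n + 1 : ℤ) : ℂ) • no2 (n - 1 - y) y

theorem hasSum_sugawara (n : ℤ) :
    HasSum (fun y : ℤ => ((2 * y - n + 1 : ℤ) : ℂ) • no2 (n - 1 - y) y) (sugawara n) :=
  hasSum_opSum ((pointwiseFinite_no2 n).smul _)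

/-- The cardinalities are positive parts; regrouped across the two ranges they give `y⁺ - (-y)⁺ = y`
and `(y-n+1)⁺ - (n-y-1)⁺ = y - n + 1`. -/
theorem sugawara_coeff (n y : ℤ) : (∑ _i ∈ Finset.Ico 0 (y - 1 + 1), (1 : ℂ) -
    ∑ _b ∈ Finset.Ico 1 (n - y), (1 : ℂ)) + (∑ _i ∈ Finset.Ico 0 (y - n + 1), (1 : ℂ) -
    ∑ _b ∈ Finset.Ico n (n - y), (1 : ℂ)) = ((2 * y - n + 1 : ℤ) : ℂ) := by
  simp only [Finset.sum_const, Int.card_Ico, nsmul_eq_mul, mul_one]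
  have e : (((y - 1 + 1 - 0).toNat : ℤ) - ((n - y - 1).toNat : ℤ)) +
      (((y - n + 1 - 0).toNat : ℤ) - ((n - y - n).toNat : ℤ)) = 2 * y - n + 1 := by omega
  rw [← e]
  push_cast
  rfl

/-- `∑_{a+b=n} :ã_a ã_b:` is fermionic bilinear. -/
theorem hasSum_aTilde_mul_aTilde {n : ℤ} (hn : n ≠ 0) :
    HasSum (fun b => (if 1 ≤ b then aTilde (n - b) * aTilde b else 0) +
      if n ≤ b then aTilde (n - b) * aTilde b else 0) (sugawara n) := by
  obtain ⟨X₁, Y₁, Z₁, h₁, hX₁, hY₁, hZ₁⟩ := hasSum_no2_mul_no2 (c := 1) (Or.inl hn) fun _ _ _ => 1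
  obtain ⟨X₂, Y₂, Z₂, h₂, hX₂, hY₂, hZ₂⟩ := hasSum_no2_mul_no2 (c := n) (Or.inl hn) fun _ _ _ => 1
  have hS : ∀ b, HasSum (fun q : ℤ × ℤ => (1 : ℂ) •
      (no2 (n - b - 1 - q.1) q.1 * no2 (b - 1 - q.2) q.2)) (aTilde (n - b) * aTilde b) := by
    intro b
    simpa only [one_smul] using hasSum_mul (hasSum_aTilde (n - b)) (hasSum_aTilde b)
  -- Exchanging the pairs turns `b ≥ n` into `b ≤ 0`, which complements `b ≥ 1`: together they give
  -- the constant coefficient `1` over all `b`, which is symmetric.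
  have hX : X₁ + X₂ = 0 := by
    refine eq_zero_of_hasSum_no4 (n := n) (f := fun _ _ _ => 1) (fun _ _ _ => rfl) ?_
    have h3 := hasSum_no4_swap_pairs (n := n) (f := fun b _ _ => if n ≤ b then 1 else 0)
      (by simpa only [ite_smul, zero_smul] using hX₂)
    refine (iff_of_eq (congrArg (HasSum · _) (funext ?_))).2 (hX₁.add h3)
    rintro ⟨b, i, j⟩
    dsimp only
    by_cases hb : 1 ≤ b
    · rw [if_pos hb, if_neg (by omega), zero_smul, add_zero]
    · rw [if_neg hb, if_pos (by omega), zero_add]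
  have hYZ : Y₁ - Z₁ + (Y₂ - Z₂) = sugawara n := by
    refine ((hY₁.sub hZ₁).add (hY₂.sub hZ₂)).unique ?_
    refine (iff_of_eq (congrArg (HasSum · _) (funext fun y => ?_))).2 (hasSum_sugawara n)
    rw [← sub_smul, ← sub_smul, ← add_smul, sugawara_coeff]
  have h3 := (hasSum_fiber_mul (f := fun _ _ _ => 1) hS h₁).add
    (hasSum_fiber_mul (f := fun _ _ _ => 1) hS h₂)
  have e : X₁ + Y₁ - Z₁ + (X₂ + Y₂ - Z₂) = (X₁ + X₂) + (Y₁ - Z₁ + (Y₂ - Z₂)) := by abel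
  rwa [e, hX, hYZ, zero_add] at h3

/-! ### Fermionic quartic and quadratic operators -/

/-- `∑ f :ψ_r ψ*_s ψ_k ψ*_l:` over `r + s + k + l = 0`, `k + l > 0`, the coefficient `f` depending
on `b = k + l` and the numbers of `s` and `l`. -/
noncomputable def quartic (f : ℤ → ℤ → ℤ → ℂ) : Op :=
  opSum fun p : ℤ × ℤ × ℤ => if 1 ≤ p.1 then f p.1 p.2.1 p.2.2 •
    no4 (0 - p.1 - 1 - p.2.1) p.2.1 (p.1 - 1 - p.2.2) p.2.2 else 0

theorem hasSum_quartic (f : ℤ → ℤ → ℤ → ℂ) :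
    HasSum (fun p : ℤ × ℤ × ℤ => if 1 ≤ p.1 then f p.1 p.2.1 p.2.2 •
      no4 (0 - p.1 - 1 - p.2.1) p.2.1 (p.1 - 1 - p.2.2) p.2.2 else 0) (quartic f) := by
  refine hasSum_opSum ?_
  simpa only [ite_smul, zero_smul] using
    (pointwiseFinite_no4 0).smul fun p => if 1 ≤ p.1 then f p.1 p.2.1 p.2.2 else 0

theorem quartic_add (f g : ℤ → ℤ → ℤ → ℂ) :
    quartic (fun b i j => f b i j + g b i j) = quartic f + quartic g := by
  refine (hasSum_quartic _).unique ?_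
  convert (hasSum_quartic f).add (hasSum_quartic g) using 2 with p
  split_ifs
  · rw [add_smul]
  · rw [add_zero]

theorem quartic_smul (c : ℂ) (f : ℤ → ℤ → ℤ → ℂ) :
    quartic (fun b i j => c * f b i j) = c • quartic f := by
  refine (hasSum_quartic _).unique ?_
  convert (hasSum_quartic f).const_smul c using 2 with p
  split_ifs
  · rw [mul_smul]
  · rw [smul_zero]

/-- `∑ g(y) :ψ_{-y} ψ*_y:`. -/
noncomputable def diagonal (g : ℤ → ℂ) : Op := opSum fun y : ℤ => g y • no2 (0 - 1 - y) y

theorem hasSum_diagonal (g : ℤ → ℂ) :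
    HasSum (fun y : ℤ => g y • no2 (0 - 1 - y) y) (diagonal g) :=
  hasSum_opSum ((pointwiseFinite_no2 0).smul g)

theorem diagonal_add (f g : ℤ → ℂ) : diagonal (fun y => f y + g y) = diagonal f + diagonal g := by
  refine (hasSum_diagonal _).unique ?_
  simpa only [add_smul] using (hasSum_diagonal f).add (hasSum_diagonal g)

theorem diagonal_smul (c : ℂ) (f : ℤ → ℂ) : diagonal (fun y => c * f y) = c • diagonal f := by
  refine (hasSum_diagonal _).unique ?_
  simpa only [mul_smul] using (hasSum_diagonal f).const_smul c

theorem diagonal_one : diagonal (fun _ => 1) = aTilde 0 := by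
  refine (hasSum_diagonal _).unique ?_
  simpa only [one_smul] using hasSum_aTilde 0

/-- A diagonal operator as a sum over positive half-integers. -/
theorem hasSum_pairs (α β : ℤ → ℂ) :
    HasSum (fun k : ℤ => if 0 < hf k then α k • (ψ (opp k) * ψs k) + β k • (ψs (opp k) * ψ k) else 0)
      (diagonal fun y => if 0 ≤ y then α y else -β (-1 - y)) := by
  have h1 := hasSum_diagonal fun y => if 0 ≤ y then α y else 0
  have h2 := hasSum_diagonal fun y => if 0 ≤ y then 0 else -β (-1 - y)
  have hinv : Function.Involutive fun k : ℤ => -1 - k := fun k => by ring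
  have h3 := (hasSum_of_injective hinv.injective (fun p hp => absurd (hinv p) (hp _))
    fun k => rfl).1 h2
  have e : (diagonal fun y => if 0 ≤ y then α y else -β (-1 - y)) =
      (diagonal fun y => if 0 ≤ y then α y else 0) +
        diagonal fun y => if 0 ≤ y then 0 else -β (-1 - y) := by
    rw [← diagonal_add]
    congr 1
    funext y
    split_ifs <;> simp
  rw [e]
  refine (iff_of_eq (congrArg (HasSum · _) (funext fun k => ?_))).2 (h1.add h3)
  simp only [hf_pos_iff, opp]
  by_cases hk : 0 ≤ k
  · rw [if_pos hk, if_pos hk, if_neg (by omega), no2_eq, if_neg (by omega), no2_eq',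
      if_neg (by omega)]
    have e1 : (0 : ℤ) - 1 - (-1 - k) = k := by ring
    have e2 : (-1 : ℤ) - (-1 - k) = k := by ring
    rw [e1, e2]
    simp
  · rw [if_neg hk, if_neg hk, if_pos (by omega), zero_smul, zero_smul, add_zero]

/-- Fermionic form of `∑_{b > 0}` of products of currents of indices `-b` and `b`. -/
theorem hasSum_mul_of_coeff {f : ℤ → ℤ → ℤ → ℂ} {S : ℤ → Op}
    (hS : ∀ b, HasSum (fun q : ℤ × ℤ => f b q.1 q.2 •
      (no2 (-b - 1 - q.1) q.1 * no2 (b - 1 - q.2) q.2)) (S b)) :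
    HasSum (fun b => if 1 ≤ b then S b else 0)
      (quartic f + diagonal fun y => ∑ i ∈ Finset.Ico 0 y, f (y - i) i y -
        ∑ b ∈ Finset.Ico 1 (-y), f b y (b + y)) := by
  obtain ⟨X, Y, Z, h, hX, hY, hZ⟩ := hasSum_no2_mul_no2 (n := 0) (c := 1) (Or.inr one_pos) f
  have e1 : X = quartic f := hX.unique (hasSum_quartic f)
  have e2 : Y - Z = diagonal fun y => ∑ i ∈ Finset.Ico 0 y, f (y - i) i y -
        ∑ b ∈ Finset.Ico 1 (-y), f b y (b + y) := by
    refine (hY.sub hZ).unique ?_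
    simpa only [sub_smul, sub_zero, zero_sub, sub_add_cancel] using hasSum_diagonal fun y =>
      ∑ i ∈ Finset.Ico 0 y, f (y - i) i y - ∑ b ∈ Finset.Ico 1 (-y), f b y (b + y)
  rw [← e1, ← e2, ← add_sub_assoc]
  exact hasSum_fiber_mul (by simpa only [zero_sub] using hS) h

/-! ### The bosonic Hamiltonians -/

/-- Summands of `∑_{n,m>0} ã_{-n-m} ã_n ã_m`. -/
noncomputable def splitTerm (p : ℤ × ℤ) : Op :=
  if 0 < p.1 ∧ 0 < p.2 then aTilde (-p.1 - p.2) * aTilde p.1 * aTilde p.2 else 0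

theorem pointwiseFinite_H1Term : PointwiseFinite H1Term := fun v => by
  obtain ⟨N, hN, hv⟩ := exists_killedFrom v
  refine ((Set.finite_Icc 0 (2 * N)).prod (Set.finite_Icc 0 (2 * N))).subset ?_
  rintro ⟨n, m⟩ h
  by_contra h'
  simp only [Set.mem_prod, Set.mem_Icc] at h'
  refine h ?_
  rw [H1Term]
  split_ifs with h0
  · dsimp only at h0 ⊢
    rw [Module.End.mul_apply, hv.aTilde hN (by omega), map_zero]
  · rfl

theorem pointwiseFinite_splitTerm : PointwiseFinite splitTerm := fun v => by
  obtain ⟨N, hN, hv⟩ := exists_killedFrom v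
  refine ((Set.finite_Icc 0 (2 * N)).prod (Set.finite_Icc 0 (2 * N))).subset ?_
  rintro ⟨n, m⟩ h
  by_contra h'
  simp only [Set.mem_prod, Set.mem_Icc] at h'
  refine h ?_
  rw [splitTerm]
  split_ifs with h0
  · dsimp only at h0 ⊢
    by_cases hm : 2 * N ≤ m
    · rw [Module.End.mul_apply, hv.aTilde hN hm, map_zero]
    -- If only `n` is large, the two annihilators are commuted so that `ã_n` acts first.
    · rw [mul_assoc, aTilde_mul_comm (by omega), Module.End.mul_apply, Module.End.mul_apply,
        hv.aTilde hN (n := n) (by omega), map_zero, map_zero]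
  · rfl

theorem pointwiseFinite_H2Term : PointwiseFinite H2Term := fun v => by
  obtain ⟨N, hN, hv⟩ := exists_killedFrom v
  refine (Set.finite_Icc 0 (2 * N)).subset fun n h => ?_
  by_contra h'
  simp only [Set.mem_Icc] at h'
  refine h ?_
  rw [H2Term]
  split_ifs with h0
  · rw [LinearMap.smul_apply, Module.End.mul_apply, hv.aTilde hN (by omega), map_zero, smul_zero]
  · rfl

theorem hasSum_H0Term : HasSum H0Term (opSum H1Term + opSum splitTerm) := by
  convert (hasSum_opSum pointwiseFinite_H1Term).add (hasSum_opSum pointwiseFinite_splitTerm)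
    using 2 with p
  rw [H0Term, H1Term, splitTerm]
  split_ifs
  · rfl
  · rw [add_zero]

theorem aMode_neg {n : ℤ} (b : ℂ) (hn : n < 0) : aMode b n = b • aTilde n := by
  rw [aMode, if_pos hn]

theorem aMode_pos {n : ℤ} (b : ℂ) (hn : 0 < n) : aMode b n = b⁻¹ • aTilde n := by
  rw [aMode, if_neg (by omega), if_pos hn]

theorem hasSum_csCubicTerm {b : ℂ} (hb : b ≠ 0) :
    HasSum (csCubicTerm b) (b ^ 2 • opSum H1Term + opSum splitTerm) := by
  convert ((hasSum_opSum pointwiseFinite_H1Term).const_smul (b ^ 2)).add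
    (hasSum_opSum pointwiseFinite_splitTerm) using 2 with p
  rw [csCubicTerm, H1Term, splitTerm]
  split_ifs with h
  · rw [aMode_neg b (by omega), aMode_neg b (by omega), aMode_pos b (by omega),
      aMode_neg b (by omega), aMode_pos b h.1, aMode_pos b h.2]
    simp only [smul_mul_assoc, mul_smul_comm, smul_add, smul_smul]
    congr 2 <;> field_simp
    rw [one_smul]
  · rw [smul_zero, add_zero]

theorem csQuadraticTerm_eq {b : ℂ} (hb : b ≠ 0) : csQuadraticTerm b = H2Term := by
  funext n
  rw [csQuadraticTerm, H2Term]
  split_ifs with h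
  · rw [aMode_neg b (by omega), aMode_pos b h, smul_mul_assoc, mul_smul_comm, smul_smul,
      smul_smul, mul_inv_cancel_right₀ hb]
  · rfl

theorem csH_eq {b : ℂ} (hb : b ≠ 0) : csH b = H0 + H1 b + H2 b := by
  rw [csH, opSum_eq_of_hasSum (hasSum_csCubicTerm hb), csQuadraticTerm_eq hb, H0,
    opSum_eq_of_hasSum hasSum_H0Term, H1, H2]
  module

theorem aTilde_zero_aTilde {v : Fock} (hv : v ∈ chargeZero) (n : ℤ) :
    aTilde 0 (aTilde n v) = 0 := by
  have h : aTilde 0 * aTilde n = aTilde n * aTilde 0 := by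
    rw [← sub_eq_zero, aTilde_commutator]
    simp
  have h1 := LinearMap.congr_fun h v
  rwa [Module.End.mul_apply, Module.End.mul_apply, LinearMap.mem_ker.1 hv, map_zero] at h1

/-- On the charge-zero sector, `∑_{n>0} L_{-n} ã_n` is a sum of the two cubic operators. -/
theorem sugawara_mul_aTilde_apply {P : Op} {v : Fock} (hv : v ∈ chargeZero)
    (hP : HasSum (fun n : ℤ => if 1 ≤ n then sugawara (-n) * aTilde n else 0) P) :
    P v = opSum H1Term v + (2 : ℂ) • opSum splitTerm v := by
  have hA : HasSum (fun p : ℤ × ℤ => if 1 ≤ p.1 ∧ -p.1 < p.2 ∧ p.2 < 0 then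
      aTilde (-p.1 - p.2) (aTilde p.2 (aTilde p.1 v)) else 0) (opSum H1Term v) := by
    refine (hasSum_of_injective (g := fun q : ℤ × ℤ => (q.1 + q.2, -q.2)) (fun a b h => ?_) ?_ ?_).2
      (hasSum_op_iff.1 (hasSum_opSum pointwiseFinite_H1Term) v)
    · simp only [Prod.mk.injEq] at h
      exact Prod.ext (by omega) (by omega)
    · rintro ⟨n, b⟩ h
      refine if_neg fun hn => h (n + b, -b) ?_
      ext <;> dsimp only <;> omega
    · rintro ⟨n, m⟩
      rw [H1Term]
      dsimp only
      by_cases h : 0 < n ∧ 0 < m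
      · rw [if_pos (by omega), if_pos h, neg_add, sub_neg_eq_add, neg_add_cancel_right]
        rfl
      · rw [if_neg (by omega), if_neg h]
        rfl
  have hB : HasSum (fun p : ℤ × ℤ => (2 : ℂ) • splitTerm (p.2, p.1) v)
      ((2 : ℂ) • opSum splitTerm v) :=
    ((Equiv.prodComm ℤ ℤ).hasSum_iff.2
      (hasSum_op_iff.1 (hasSum_opSum pointwiseFinite_splitTerm) v)).map
      (DistribSMul.toAddMonoidHom Fock (2 : ℂ)) continuous_of_discreteTopology
  refine (hasSum_op_iff.1 hP v).unique ((hA.add hB).prod_fiberwise fun n => ?_)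
  by_cases hn : 1 ≤ n
  · have h := hasSum_op_iff.1 (hasSum_aTilde_mul_aTilde (n := -n) (by omega)) (aTilde n v)
    rw [if_pos hn]
    refine (iff_of_eq (congrArg (HasSum · _) (funext fun b => ?_))).2 h
    rw [splitTerm]
    dsimp only
    have hc : -b - n = -n - b := by ring
    rw [hc]
    -- For `b > 0` both ranges of the Sugawara sum contribute, whence the factor `2` on `splitTerm`;
    -- `-n < b < 0` contributes once, to `H1Term`; `b = 0` and `b = -n` contain `ã_0`.
    rcases lt_trichotomy b 0 with hb | rfl | hb
    · rw [if_neg (c := 0 < b ∧ 0 < n) (by omega), if_neg (c := 1 ≤ b) (by omega)]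
      rcases lt_trichotomy b (-n) with hbn | rfl | hbn
      · rw [if_neg (by omega), if_neg (by omega)]
        simp
      · rw [if_neg (by omega), if_pos le_rfl, sub_self, LinearMap.add_apply, Module.End.mul_apply]
        have h0 : aTilde 0 (aTilde (-n) (aTilde n v)) = 0 := by
          have h1 : aTilde n v ∈ chargeZero := LinearMap.mem_ker.2 (aTilde_zero_aTilde hv n)
          exact aTilde_zero_aTilde h1 (-n)
        rw [h0]
        simp
      · rw [if_pos (by omega), if_pos (by omega)]
        simp
    · rw [aTilde_zero_aTilde hv, map_zero, if_neg (by omega), if_neg (by omega), if_neg (by omega),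
        if_pos (by omega), zero_add, LinearMap.add_apply, Module.End.mul_apply,
        aTilde_zero_aTilde hv, map_zero]
      simp
    · rw [if_neg (by omega), if_pos (by omega), if_pos (by omega), if_pos (by omega), zero_add,
        two_smul]
      rfl
  · rw [if_neg hn, LinearMap.zero_apply]
    convert hasSum_zero with b
    rw [if_neg (fun h => hn h.1), splitTerm, if_neg (by dsimp only; omega)]
    simp

/-- On the charge-zero sector, `∑_{n>0} ã_{-n} L_n` is a sum of the two cubic operators. -/
theorem aTilde_mul_sugawara_apply {Q : Op} {v : Fock} (hv : v ∈ chargeZero)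
    (hQ : HasSum (fun n : ℤ => if 1 ≤ n then aTilde (-n) * sugawara n else 0) Q) :
    Q v = opSum splitTerm v + (2 : ℂ) • opSum H1Term v := by
  have hB : HasSum (fun p : ℤ × ℤ => if 1 ≤ p.2 ∧ p.2 < p.1 then
      aTilde (-p.1) (aTilde (p.1 - p.2) (aTilde p.2 v)) else 0) (opSum splitTerm v) := by
    refine (hasSum_of_injective (g := fun q : ℤ × ℤ => (q.1 + q.2, q.2)) (fun a b h => ?_) ?_ ?_).2
      (hasSum_op_iff.1 (hasSum_opSum pointwiseFinite_splitTerm) v)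
    · simp only [Prod.mk.injEq] at h
      exact Prod.ext (by omega) (by omega)
    · rintro ⟨n, b⟩ h
      refine if_neg fun hn => h (n - b, b) ?_
      ext <;> dsimp only
      omega
    · rintro ⟨n, m⟩
      rw [splitTerm]
      dsimp only
      by_cases h : 0 < n ∧ 0 < m
      · rw [if_pos (by omega), if_pos h, neg_add, add_sub_cancel_right]
        rfl
      · rw [if_neg (by omega), if_neg h]
        rfl
  have hA : HasSum (fun p : ℤ × ℤ => if 1 ≤ p.1 ∧ p.1 < p.2 then
      aTilde (-p.1) (aTilde (p.1 - p.2) (aTilde p.2 v)) else 0) (opSum H1Term v) := by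
    refine (hasSum_of_injective (g := fun q : ℤ × ℤ => (q.1, q.1 + q.2)) (fun a b h => ?_) ?_ ?_).2
      (hasSum_op_iff.1 (hasSum_opSum pointwiseFinite_H1Term) v)
    · simp only [Prod.mk.injEq] at h
      exact Prod.ext (by omega) (by omega)
    · rintro ⟨n, b⟩ h
      refine if_neg fun hn => h (n, b - n) ?_
      ext <;> dsimp only
      omega
    · rintro ⟨n, m⟩
      rw [H1Term]
      dsimp only
      by_cases h : 0 < n ∧ 0 < m
      · rw [if_pos (by omega), if_pos h, sub_add_cancel_left]
        rfl
      · rw [if_neg (by omega), if_neg h]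
        rfl
  have hA2 := hA.map (DistribSMul.toAddMonoidHom Fock (2 : ℂ)) continuous_of_discreteTopology
  refine (hasSum_op_iff.1 hQ v).unique ((hB.add hA2).prod_fiberwise fun n => ?_)
  by_cases hn : 1 ≤ n
  · have h := (hasSum_op_iff.1 (hasSum_aTilde_mul_aTilde (n := n) (by omega)) v).map
      (aTilde (-n) : Fock →+ Fock) continuous_of_discreteTopology
    rw [if_pos hn]
    refine (iff_of_eq (congrArg (HasSum · _) (funext fun b => ?_))).2 h
    simp only [Function.comp_apply, DistribSMul.toAddMonoidHom_apply, AddMonoidHom.coe_coe,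
      LinearMap.add_apply, map_add]
    -- Here `1 ≤ b < n` is counted once and gives `splitTerm`, `b > n` twice and gives `H1Term`, and
    -- `b = n` contains `ã_0`.
    rcases lt_trichotomy b n with hb | rfl | hb
    · rw [if_neg (c := 1 ≤ n ∧ n < b) (by omega), if_neg (c := n ≤ b) (by omega)]
      by_cases hb1 : 1 ≤ b
      · rw [if_pos ⟨hb1, hb⟩, if_pos hb1]
        simp
      · rw [if_neg (by omega), if_neg hb1]
        simp
    · simp only [lt_irrefl, and_false, if_false, if_pos hn, le_refl, if_true, sub_self,
        Module.End.mul_apply, aTilde_zero_aTilde hv]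
      simp
    · rw [if_neg (by omega), if_pos (by omega), if_pos (by omega), if_pos (by omega), zero_add,
        two_smul]
      rfl
  · rw [if_neg hn, LinearMap.zero_apply]
    convert hasSum_zero with b
    simp only [Function.comp_apply, DistribSMul.toAddMonoidHom_apply]
    rw [if_neg (by omega), if_neg (by omega)]
    simp

/-! ### Fermionization -/

theorem sum_Ico_linear (c d : ℂ) {a m : ℤ} (h : a ≤ m) :
    ∑ i ∈ Finset.Ico a m, (c + d * i) = c * (m - a) + d * ((m * (m - 1) - a * (a - 1)) / 2) := by
  induction m, h using Int.leInduction with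
  | base => simp
  | succ m hm ih =>
    have e : Finset.Ico a (m + 1) = insert m (Finset.Ico a m) := by
      ext i
      simp only [Finset.mem_Ico, Finset.mem_insert]
      omega
    rw [e, Finset.sum_insert (by simp), ih]
    push_cast
    ring

/-- According to the sign of `y`, at most one of the two contraction ranges is nonempty. -/
theorem sum_Ico_sub_sum_Ico (c d c' d' : ℤ → ℂ) (y : ℤ) :
    ∑ i ∈ Finset.Ico 0 y, (c y + d y * i) - ∑ b ∈ Finset.Ico 1 (-y), (c' y + d' y * b) =
      if 0 ≤ y then c y * y + d y * (y * (y - 1) / 2)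
      else -(c' y * (-y - 1) + d' y * (y * (y + 1) / 2)) := by
  split_ifs with h
  · rw [sum_Ico_linear _ _ h, Finset.Ico_eq_empty (by omega : ¬(1 : ℤ) < -y), Finset.sum_empty]
    push_cast
    ring
  · rw [sum_Ico_linear _ _ (by omega : (1 : ℤ) ≤ -y), Finset.Ico_eq_empty (by omega : ¬(0 : ℤ) < y),
      Finset.sum_empty]
    push_cast
    ring

/-- The coefficient of the quadratic part of the cubic operators. -/
noncomputable def cubicCoeff (y : ℤ) : ℂ :=
  if 0 ≤ y then y * (3 * y + 1) / 2 else (-1 - y) * (3 * (-1 - y) + 1) / 2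

/-- The coefficient of the quadratic part of `∑_{n>0} n ã_{-n} ã_n`. -/
noncomputable def quadraticCoeff (y : ℤ) : ℂ :=
  if 0 ≤ y then y * (y + 1) / 2 else -(y * (y + 1) / 2)

/-- The coefficient `2i + b + 1` is `s - r`, as `r + s = -b`. -/
theorem hasSum_sugawara_mul_aTilde :
    HasSum (fun n : ℤ => if 1 ≤ n then sugawara (-n) * aTilde n else 0)
      (quartic (fun b i _ => 2 * i + b + 1) + diagonal cubicCoeff) := by
  have h := hasSum_mul_of_coeff (f := fun b i _ => 2 * i + b + 1)
    (S := fun n => sugawara (-n) * aTilde n) fun b => ?_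
  · convert h using 3
    funext y
    rw [cubicCoeff]
    have e := sum_Ico_sub_sum_Ico (fun y => y + 1) (fun _ => 1) (fun y => 2 * y + 1) (fun _ => 1) y
    convert e.symm using 1
    · split_ifs <;> ring
    · congr 1 <;> refine Finset.sum_congr rfl fun i _ => ?_ <;> push_cast <;> ring
  · convert hasSum_mul (hasSum_sugawara (-b)) (hasSum_aTilde b) using 2 with q
    rw [smul_mul_assoc]
    congr 1
    push_cast
    ring

/-- The coefficient `2j - b + 1` is `l - k`. On the contracted indices it agrees with the
coefficient `s - r` of the mirror product, hence the same quadratic part. -/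
theorem hasSum_aTilde_mul_sugawara :
    HasSum (fun n : ℤ => if 1 ≤ n then aTilde (-n) * sugawara n else 0)
      (quartic (fun b _ j => 2 * j - b + 1) + diagonal cubicCoeff) := by
  have h := hasSum_mul_of_coeff (f := fun b _ j => 2 * j - b + 1)
    (S := fun n => aTilde (-n) * sugawara n) fun b => ?_
  · convert h using 3
    funext y
    rw [cubicCoeff]
    have e := sum_Ico_sub_sum_Ico (fun y => y + 1) (fun _ => 1) (fun y => 2 * y + 1) (fun _ => 1) y
    convert e.symm using 1
    · split_ifs <;> ring
    · congr 1 <;> refine Finset.sum_congr rfl fun i _ => ?_ <;> push_cast <;> ring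
  · convert hasSum_mul (hasSum_aTilde (-b)) (hasSum_sugawara b) using 2 with q
    rw [mul_smul_comm]
    congr 1
    push_cast
    ring

theorem hasSum_H2Term : HasSum H2Term (quartic (fun b _ _ => b) + diagonal quadraticCoeff) := by
  have h := hasSum_mul_of_coeff (f := fun b _ _ => b)
    (S := fun n => (n : ℂ) • (aTilde (-n) * aTilde n)) fun b => ?_
  · convert h using 3
    · exact if_congr (by omega) rfl rfl
    funext y
    rw [quadraticCoeff]
    have e := sum_Ico_sub_sum_Ico (fun y => y) (fun _ => -1) (fun y => 0) (fun _ => 1) y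
    convert e.symm using 1
    · split_ifs <;> ring
    · congr 1 <;> refine Finset.sum_congr rfl fun i _ => ?_ <;> push_cast <;> ring
  · exact (hasSum_mul (hasSum_aTilde (-b)) (hasSum_aTilde b)).const_smul (b : ℂ)

/-- Both factors have index zero, so only `i = j` contracts: through `ψ*_s ψ_k` if `i ≥ 0`, through
`ψ_r ψ*_l` with the opposite sign if `i < 0`, never both. -/
theorem diagonal_mul_aTilde_zero (g : ℤ → ℂ) {E : Op}
    (hE : HasSum (fun q : ℤ × ℤ => g q.1 • no4 (0 - 1 - q.1) q.1 (0 - 1 - q.2) q.2) E) :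
    diagonal g * aTilde 0 = E + diagonal fun y => if 0 ≤ y then g y else -g y := by
  have h1 := hasSum_mul (hasSum_diagonal g) (hasSum_aTilde 0)
  have h2 : HasSum (fun q : ℤ × ℤ => if q.1 = q.2 then
      (if 0 ≤ q.1 then g q.1 else -g q.1) • no2 (0 - 1 - q.1) q.1 else 0)
      (diagonal fun y => if 0 ≤ y then g y else -g y) := by
    refine (hasSum_of_injective (g := fun y : ℤ => (y, y)) (fun a b h => (Prod.ext_iff.1 h).1)
      ?_ fun y => ?_).2 (hasSum_diagonal fun y => if 0 ≤ y then g y else -g y)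
    · rintro ⟨i, j⟩ h
      refine if_neg fun hn => h i ?_
      ext <;> dsimp only at hn ⊢
      exact hn
    · exact if_pos rfl
  refine h1.unique ((iff_of_eq (congrArg (HasSum · _) (funext ?_))).2 (hE.add h2))
  rintro ⟨i, j⟩
  dsimp only
  rw [smul_mul_assoc, no2_mul_no2]
  by_cases hij : i = j
  · subst hij
    rw [if_pos rfl]
    by_cases hi : 0 ≤ i
    · rw [if_pos (by omega), if_neg (by omega), if_pos hi]
      simp
    · rw [if_neg (by omega), if_pos (by omega), if_neg hi]
      simp [sub_eq_add_neg]
  · rw [if_neg (by omega), if_neg (by omega), if_neg hij]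
    simp

/-- On the charge-zero sector a quartic sum with symmetric linear coefficient is quadratic. -/
theorem quartic_symm_apply {v : Fock} (hv : v ∈ chargeZero) :
    quartic (fun _ i j => (2 * i + 1) + (2 * j + 1)) v =
      diagonal (fun y => if 0 ≤ y then 2 * y + 1 else -(2 * y + 1)) v := by
  set K := quartic fun _ i j => (2 * i + 1) + (2 * j + 1) with hK
  have hall := hasSum_opSum ((pointwiseFinite_no4 0).smul
    fun p : ℤ × ℤ × ℤ => (2 * p.2.1 + 1 : ℂ) + (2 * p.2.2 + 1))
  have h0 := eq_zero_of_hasSum_no4 (n := 0) (f := fun _ i j => (2 * i + 1) + (2 * j + 1))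
    (fun b i j => by ring) hall
  rw [h0] at hall
  have hK1 := hasSum_quartic fun _ i j => (2 * i + 1) + (2 * j + 1)
  have hK2 := hasSum_no4_swap_pairs (n := 0)
    (f := fun b i j => if 1 ≤ b then (2 * i + 1) + (2 * j + 1) else 0) (X := K)
    (by simpa only [ite_smul, zero_smul] using hK1)
  have hE1 := hasSum_opSum ((pointwiseFinite_no4 0).smul
    fun p : ℤ × ℤ × ℤ => if p.1 = 0 then (2 * p.2.1 + 1 : ℂ) else 0)
  set E := opSum _ with hE
  have hE2 := hasSum_no4_swap_pairs (n := 0)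
    (f := fun b i _ => if b = 0 then (2 * i + 1 : ℂ) else 0) hE1
  -- The full symmetric sum vanishes. Its parts `b > 0` and `b < 0` are both `K` by exchange of
  -- pairs; the `b = 0` part splits into two halves, also equal by that exchange.
  have hKE : K + K + (E + E) = 0 := by
    refine HasSum.unique ?_ hall
    refine (iff_of_eq (congrArg (HasSum · _) (funext ?_))).2 ((hK1.add hK2).add (hE1.add hE2))
    rintro ⟨b, i, j⟩
    dsimp only
    rcases lt_trichotomy b 0 with hb | hb | hb
    · rw [if_neg (c := 1 ≤ b) (by omega), if_pos (by omega), if_neg (by omega), if_neg (by omega)]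
      module
    · rw [if_neg (c := 1 ≤ b) (by omega), if_neg (by omega), if_pos (by omega), if_pos (by omega)]
      module
    · rw [if_pos (c := 1 ≤ b) (by omega), if_neg (by omega), if_neg (by omega), if_neg (by omega)]
      module
  have hKE' : K = -E := by
    have e : K = (1 / 2 : ℂ) • (K + K + (E + E)) - E := by module
    rw [e, hKE, smul_zero, zero_sub]
  have hE3 : HasSum (fun q : ℤ × ℤ =>
      (2 * q.1 + 1 : ℂ) • no4 (0 - 1 - q.1) q.1 (0 - 1 - q.2) q.2) E := by
    refine (hasSum_of_injective (g := fun q : ℤ × ℤ => ((0 : ℤ), q))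
      (fun a b h => (Prod.ext_iff.1 h).2) ?_ fun q => ?_).1 hE1
    · rintro ⟨b, q⟩ h
      dsimp only
      rw [if_neg, zero_smul]
      rintro rfl
      exact h q rfl
    · dsimp only
      rw [if_pos rfl, sub_zero]
  have h := LinearMap.congr_fun (diagonal_mul_aTilde_zero (fun y => 2 * y + 1) hE3) v
  rw [Module.End.mul_apply, LinearMap.mem_ker.1 hv, map_zero, LinearMap.add_apply] at h
  rw [hKE', LinearMap.neg_apply, neg_eq_iff_add_eq_zero, ← h]

/-! ### Sums over quadruples of half-integers -/

theorem hasSum_quadruples (c : ℤ → ℤ → ℤ → ℤ → ℂ) :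
    HasSum (fun p : ℤ × ℤ × ℤ × ℤ =>
      if hf p.1 + hf p.2.1 + hf p.2.2.1 + hf p.2.2.2 = 0 ∧ 0 < hf p.2.2.1 + hf p.2.2.2 then
        c p.1 p.2.1 p.2.2.1 p.2.2.2 • no4 p.1 p.2.1 p.2.2.1 p.2.2.2 else 0)
      (quartic fun b i j => c (0 - b - 1 - i) i (b - 1 - j) j) := by
  have e1 : ∀ r s k l : ℤ, hf r + hf s + hf k + hf l = 0 ↔ r + s + k + l = -2 := by
    intro r s k l
    simp only [hf]
    rw [← Int.cast_inj (α := ℚ)]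
    push_cast
    constructor <;> intro h <;> linarith
  have e2 : ∀ k l : ℤ, 0 < hf k + hf l ↔ 0 < k + l + 1 := by
    intro k l
    simp only [hf]
    rw [← Int.cast_lt (R := ℚ)]
    push_cast
    constructor <;> intro h <;> linarith
  refine (hasSum_of_injective
    (g := fun q : ℤ × ℤ × ℤ => (0 - q.1 - 1 - q.2.1, q.2.1, q.1 - 1 - q.2.2, q.2.2))
    (fun a b h => ?_) ?_ ?_).2 (hasSum_quartic _)
  · simp only [Prod.mk.injEq] at h
    exact Prod.ext (by omega) (Prod.ext (by omega) (by omega))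
  · rintro ⟨r, s, k, l⟩ h
    refine if_neg fun hn => h (k + l + 1, s, l) ?_
    simp only [e1] at hn
    ext <;> dsimp only
    · omega
    · omega
  · rintro ⟨b, i, j⟩
    refine if_congr ?_ rfl rfl
    rw [e1, e2]
    dsimp only
    omega

theorem hasSum_F1QuarticTerm :
    HasSum F1QuarticTerm (quartic fun b i j => 1 / 2 * (2 * i + b + 1) + -1 * (2 * j - b + 1)) := by
  have h := hasSum_quadruples fun r s k l => ((1 / 2 * (hf s - hf r) + hf k - hf l : ℚ) : ℂ)
  convert h using 1
  · funext ⟨r, s, k, l⟩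
    refine if_congr ?_ rfl rfl
    dsimp only
    constructor
    · exact fun h => ⟨h.2.2, h.2.1⟩
    · exact fun h => ⟨by linarith [h.1, h.2], h.2, h.1⟩
  · congr 1
    funext b i j
    simp only [hf]
    push_cast
    ring

theorem hasSum_F2QuarticTerm : HasSum F2QuarticTerm (quartic fun b _ _ => b) := by
  have h := hasSum_quadruples fun r s k l => ((hf k + hf l : ℚ) : ℂ)
  convert h using 1
  · funext ⟨r, s, k, l⟩
    refine if_congr ?_ rfl rfl
    dsimp only
    constructor
    · exact fun h => ⟨h.2.2, h.2.1⟩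
    · exact fun h => ⟨by linarith [h.1, h.2], h.2, h.1⟩
  · congr 1
    funext b i j
    simp only [hf]
    push_cast
    ring

/-- With `r = -s-k-l`, the combination `(2/3)((s-r)/2 + k - l) + (k + l)` becomes `2k + (2/3)(s +
l)`. -/
theorem hasSum_interaction :
    HasSum (fun p : ℤ × ℤ × ℤ × ℤ =>
      if hf p.1 + hf p.2.1 + hf p.2.2.1 + hf p.2.2.2 = 0 ∧ 0 < hf p.2.2.1 + hf p.2.2.2 then
        ((2 * hf p.2.2.1 + 2 / 3 * (hf p.2.1 + hf p.2.2.2) : ℚ) : ℂ) •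
          no4 p.1 p.2.1 p.2.2.1 p.2.2.2 else 0)
      (quartic fun b i j =>
        2 / 3 * (1 / 2 * (2 * i + b + 1) + -1 * (2 * j - b + 1)) + b) := by
  convert hasSum_quadruples fun r s k l => ((2 * hf k + 2 / 3 * (hf s + hf l) : ℚ) : ℂ) using 1
  congr 1
  funext b i j
  simp only [hf]
  push_cast
  ring

theorem pointwiseFinite_HtTerm : PointwiseFinite HtTerm := by
  refine PointwiseFinite.of_forall (pointwiseFinite_of_summable hasSum_interaction.summable)
    fun v => ⟨fun p => {p}, ?_⟩
  rintro ⟨r, s, k, l⟩ h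
  refine ⟨(r, s, k, l), ?_, Finset.mem_singleton_self _⟩
  rw [HtTerm] at h
  dsimp only at h ⊢
  split_ifs at h with h1
  · rwa [if_pos ⟨h1.1, h1.2.1⟩]
  · exact absurd rfl h

theorem hf_add_hf_eq_zero_iff {k s : ℤ} : hf k + hf s = 0 ↔ s = opp k := by
  simp only [hf, opp]
  rw [← Int.cast_inj (α := ℚ)]
  push_cast
  constructor <;> intro h <;> linarith

theorem injective_diagonalQuadruple :
    Function.Injective fun q : ℤ × ℤ => (opp q.2, opp q.1, q.1, q.2) := by
  intro a b h
  simp only [Prod.mk.injEq] at h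
  exact Prod.ext h.2.2.1 h.2.2.2

theorem HdQuarticTerm_eq (q : ℤ × ℤ) : HdQuarticTerm q =
    if hf (opp q.2) + hf (opp q.1) + hf q.1 + hf q.2 = 0 ∧ 0 < hf q.1 + hf q.2 then
        ((2 * hf q.1 + 2 / 3 * (hf (opp q.1) + hf q.2) : ℚ) : ℂ) •
          no4 (opp q.2) (opp q.1) q.1 q.2 else 0 := by
  obtain ⟨k, l⟩ := q
  rw [HdQuarticTerm]
  dsimp only
  refine if_congr ?_ ?_ rfl
  · rw [hf_opp, hf_opp]
    exact ⟨fun h => ⟨by ring, h⟩, fun h => h.2⟩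
  · rw [hf_opp]
    congr 2
    ring

theorem pointwiseFinite_HdQuarticTerm : PointwiseFinite HdQuarticTerm := by
  have h := (pointwiseFinite_of_summable hasSum_interaction.summable).comp_injective
    injective_diagonalQuadruple
  rw [funext HdQuarticTerm_eq]
  exact h

/-- When `k + s = 0`, total index zero forces `r = -l`, so these quadruples are exactly the image of
the pairs `(k, l)`. -/
theorem opSum_HdQuarticTerm_add_Ht : opSum HdQuarticTerm + Ht =
    quartic fun b i j => 2 / 3 * (1 / 2 * (2 * i + b + 1) + -1 * (2 * j - b + 1)) + b := by
  have h : HasSum (fun p : ℤ × ℤ × ℤ × ℤ => if p.2.1 = opp p.2.2.1 then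
      (if hf p.1 + hf p.2.1 + hf p.2.2.1 + hf p.2.2.2 = 0 ∧ 0 < hf p.2.2.1 + hf p.2.2.2 then
        ((2 * hf p.2.2.1 + 2 / 3 * (hf p.2.1 + hf p.2.2.2) : ℚ) : ℂ) •
          no4 p.1 p.2.1 p.2.2.1 p.2.2.2 else 0) else 0) (opSum HdQuarticTerm) := by
    refine (hasSum_of_injective injective_diagonalQuadruple ?_ fun q => ?_).2
      (hasSum_opSum pointwiseFinite_HdQuarticTerm)
    · rintro ⟨r, s, k, l⟩ hp
      dsimp only
      split_ifs with h1 h2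
      · refine absurd ?_ (hp (k, l))
        have h3 : r = opp l := by
          rw [← hf_add_hf_eq_zero_iff]
          have := hf_add_hf_eq_zero_iff.2 h1
          linarith [h2.1]
        rw [h1, h3]
      · rfl
      · rfl
    · rw [HdQuarticTerm_eq]
      exact if_pos rfl
  refine (h.add (hasSum_opSum pointwiseFinite_HtTerm)).unique ?_
  refine (iff_of_eq (congrArg (HasSum · _) (funext ?_))).2 hasSum_interaction
  rintro ⟨r, s, k, l⟩
  rw [HtTerm]
  dsimp only
  by_cases hs : s = opp k
  · have h0 : ¬(hf r + hf s + hf k + hf l = 0 ∧ 0 < hf k + hf l ∧ hf k + hf s ≠ 0) :=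
      fun h => h.2.2 (hf_add_hf_eq_zero_iff.2 hs)
    rw [if_pos hs, if_neg h0, add_zero]
  · rw [if_neg hs, zero_add]
    refine if_congr ?_ rfl rfl
    have hs' : hf k + hf s ≠ 0 := mt hf_add_hf_eq_zero_iff.1 hs
    tauto

/-! ### Quadratic sums -/

theorem hasSum_freeTerm : HasSum freeTerm (diagonal fun y => (y + 1 / 2) ^ 2 + 3 / 4) := by
  convert hasSum_pairs (fun k => ((hf k ^ 2 + 3 / 4 : ℚ) : ℂ))
    (fun k => -((hf k ^ 2 + 3 / 4 : ℚ) : ℂ)) using 1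
  · funext k
    rw [freeTerm, smul_sub, neg_smul, sub_eq_add_neg]
  · congr 1
    funext y
    simp only [hf]
    push_cast
    split_ifs <;> ring

theorem hasSum_F1QuadraticTerm : HasSum F1QuadraticTerm (diagonal fun y => 8 * cubicCoeff y) := by
  convert hasSum_pairs (fun k => (((6 * hf k - 1) * (2 * hf k - 1) : ℚ) : ℂ))
    (fun k => -(((6 * hf k - 1) * (2 * hf k - 1) : ℚ) : ℂ)) using 1
  · funext k
    rw [F1QuadraticTerm, smul_sub, neg_smul, sub_eq_add_neg]
  · congr 1
    funext y
    simp only [hf, cubicCoeff]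
    push_cast
    split_ifs <;> ring

theorem hasSum_F2QuadraticTerm : HasSum F2QuadraticTerm (diagonal quadraticCoeff) := by
  convert hasSum_pairs (fun k => ((1 / 2 * (hf k ^ 2 - 1 / 4) : ℚ) : ℂ))
    (fun k => ((1 / 2 * (hf k ^ 2 - 1 / 4) : ℚ) : ℂ)) using 1
  · funext k
    rw [F2QuadraticTerm, smul_add]
  · congr 1
    funext y
    simp only [hf, quadraticCoeff]
    push_cast
    split_ifs <;> ring

theorem hasSum_HdQuadraticTerm : HasSum HdQuadraticTerm
    (diagonal fun y => 2 / 3 * (-1 / 2 * cubicCoeff y) + quadraticCoeff y) := by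
  convert hasSum_pairs (fun k => ((1 / 3 * (hf k - 1 / 2) : ℚ) : ℂ))
    (fun k => (((hf k - 1 / 2) * (hf k + 1 / 6) : ℚ) : ℂ)) using 1
  · rfl
  · congr 1
    funext y
    simp only [hf, cubicCoeff, quadraticCoeff]
    push_cast
    split_ifs <;> ring

theorem F1_eq : F1 =
    quartic (fun b i j => 1 / 2 * (2 * i + b + 1) + -1 * (2 * j - b + 1)) +
      diagonal fun y => -1 / 2 * cubicCoeff y := by
  rw [F1, opSum_eq_of_hasSum hasSum_F1QuarticTerm, opSum_eq_of_hasSum hasSum_F1QuadraticTerm,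
    diagonal_smul, diagonal_smul]
  module

theorem F2_eq : F2 = quartic (fun b _ _ => b) + diagonal quadraticCoeff := by
  rw [F2, opSum_eq_of_hasSum hasSum_F2QuarticTerm, opSum_eq_of_hasSum hasSum_F2QuadraticTerm]

theorem Hd_add_Ht : Hd + Ht = (2 / 3 : ℂ) • F1 + F2 := by
  rw [Hd, add_assoc, opSum_HdQuarticTerm_add_Ht, opSum_eq_of_hasSum hasSum_HdQuadraticTerm, F1_eq,
    F2_eq, quartic_add, quartic_smul (2 / 3), diagonal_add, diagonal_smul (2 / 3)]
  module

theorem H2_eq (b : ℂ) : H2 b = (1 - b ^ 2) • F2 := by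
  rw [H2, opSum_eq_of_hasSum hasSum_H2Term, F2_eq]

/-- `F_1` has the fermionic form of `P/2 - Q`, and `(A + 2B)/2 - (B + 2A) = -(3/2) A`. -/
theorem F1_apply {v : Fock} (hv : v ∈ chargeZero) :
    F1 v = (-(3 / 2) : ℂ) • opSum H1Term v := by
  have hP := sugawara_mul_aTilde_apply hv hasSum_sugawara_mul_aTilde
  have hQ := aTilde_mul_sugawara_apply hv hasSum_aTilde_mul_sugawara
  rw [LinearMap.add_apply] at hP hQ
  rw [F1_eq, quartic_add, quartic_smul, quartic_smul, diagonal_smul]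
  simp only [LinearMap.add_apply, LinearMap.smul_apply]
  rw [eq_sub_of_add_eq hP, eq_sub_of_add_eq hQ]
  module

theorem H1_apply (b : ℂ) {v : Fock} (hv : v ∈ chargeZero) :
    H1 b v = ((2 / 3 : ℂ) * (1 - b ^ 2)) • F1 v := by
  rw [F1_apply hv, H1, LinearMap.smul_apply, LinearMap.neg_apply]
  module

theorem H0_apply {v : Fock} (hv : v ∈ chargeZero) : H0 v = freeH v := by
  have hP := sugawara_mul_aTilde_apply hv hasSum_sugawara_mul_aTilde
  have hQ := aTilde_mul_sugawara_apply hv hasSum_aTilde_mul_sugawara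
  have hS := quartic_symm_apply hv
  have e : (fun _ i j => (2 * i + 1) + (2 * j + 1) : ℤ → ℤ → ℤ → ℂ) =
      (fun b i j => (2 * i + b + 1) + (2 * j - b + 1) : ℤ → ℤ → ℤ → ℂ) := by
    funext b i j
    ring
  rw [e, quartic_add] at hS
  -- The bilinear form of `(P + Q)/3` has coefficient `y² + y + 1/3`, against `y² + y + 1` for
  -- `freeH`. The constant discrepancy is a multiple of the charge.
  have hF : freeH + (-2 / 3 : ℂ) • aTilde 0 =
      (1 / 3 : ℂ) • diagonal (fun y => if 0 ≤ y then 2 * y + 1 else -(2 * y + 1))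
        + (2 / 3 : ℂ) • diagonal cubicCoeff := by
    rw [freeH, opSum_eq_of_hasSum hasSum_freeTerm, ← diagonal_one, ← diagonal_smul, ← diagonal_smul,
      ← diagonal_smul, ← diagonal_add, ← diagonal_add]
    congr 1
    funext y
    simp only [cubicCoeff]
    split_ifs <;> ring
  have hF' := LinearMap.congr_fun hF v
  simp only [LinearMap.add_apply, LinearMap.smul_apply] at hF' hS hP hQ
  rw [LinearMap.mem_ker.1 hv, smul_zero, add_zero] at hF'
  rw [H0, opSum_eq_of_hasSum hasSum_H0Term, LinearMap.add_apply, hF', ← hS, eq_sub_of_add_eq hP,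
    eq_sub_of_add_eq hQ]
  module

end CSFermion

theorem mainTheorem3 (b : ℂ) (hb : b ≠ 0) :
    -- every infinite sum below is finite on each vector of the Fock space
    ((∀ n : ℤ, CSFermion.PointwiseFinite (CSFermion.aTildeTerm n)) ∧
      CSFermion.PointwiseFinite (CSFermion.csCubicTerm b) ∧
      CSFermion.PointwiseFinite (CSFermion.csQuadraticTerm b) ∧
      CSFermion.PointwiseFinite CSFermion.H0Term ∧
      CSFermion.PointwiseFinite CSFermion.H1Term ∧
      CSFermion.PointwiseFinite CSFermion.H2Term ∧
      CSFermion.PointwiseFinite CSFermion.freeTerm ∧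
      CSFermion.PointwiseFinite CSFermion.F1QuarticTerm ∧
      CSFermion.PointwiseFinite CSFermion.F1QuadraticTerm ∧
      CSFermion.PointwiseFinite CSFermion.F2QuarticTerm ∧
      CSFermion.PointwiseFinite CSFermion.F2QuadraticTerm ∧
      CSFermion.PointwiseFinite CSFermion.HdQuadraticTerm ∧
      CSFermion.PointwiseFinite CSFermion.HdQuarticTerm ∧
      CSFermion.PointwiseFinite CSFermion.HtTerm) ∧
    -- the modes `ã_n` satisfy the Heisenberg algebra, and the vacuum is their vacuum
    (∀ m n : ℤ, CSFermion.aTilde m * CSFermion.aTilde n - CSFermion.aTilde n * CSFermion.aTilde m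
      = if m + n = 0 then (m : ℂ) • (1 : CSFermion.Op) else 0) ∧
    (∀ n : ℤ, 0 ≤ n → CSFermion.aTilde n CSFermion.vac = 0) ∧
    -- the bosonic decomposition
    CSFermion.csH b = CSFermion.H0 + CSFermion.H1 b + CSFermion.H2 b ∧
    -- fermionization on the charge-zero sector
    (∀ v ∈ CSFermion.chargeZero,
      CSFermion.H0 v = CSFermion.freeH v ∧
      CSFermion.H1 b v = ((2 / 3 : ℂ) * (1 - b ^ 2)) • CSFermion.F1 v ∧
      CSFermion.H2 b v = (1 - b ^ 2) • CSFermion.F2 v ∧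
      CSFermion.csH b v = CSFermion.freeH v + ((2 / 3 : ℂ) * (1 - b ^ 2)) • CSFermion.F1 v
        + (1 - b ^ 2) • CSFermion.F2 v ∧
      CSFermion.csH b v = CSFermion.freeH v + (1 - b ^ 2) • CSFermion.Hd v
        + (1 - b ^ 2) • CSFermion.Ht v) := by
  open CSFermion in
  refine ⟨⟨pointwiseFinite_aTildeTerm, pointwiseFinite_of_summable (hasSum_csCubicTerm hb).summable,
    csQuadraticTerm_eq hb ▸ pointwiseFinite_H2Term,
    pointwiseFinite_of_summable hasSum_H0Term.summable, pointwiseFinite_H1Term,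
    pointwiseFinite_H2Term, pointwiseFinite_of_summable hasSum_freeTerm.summable,
    pointwiseFinite_of_summable hasSum_F1QuarticTerm.summable,
    pointwiseFinite_of_summable hasSum_F1QuadraticTerm.summable,
    pointwiseFinite_of_summable hasSum_F2QuarticTerm.summable,
    pointwiseFinite_of_summable hasSum_F2QuadraticTerm.summable,
    pointwiseFinite_of_summable hasSum_HdQuadraticTerm.summable,
    pointwiseFinite_HdQuarticTerm, pointwiseFinite_HtTerm⟩,
    aTilde_commutator, fun n => aTilde_vac, csH_eq hb, fun v hv => ?_⟩
  have h0 := H0_apply hv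
  have h1 := H1_apply b hv
  have h2 : H2 b v = (1 - b ^ 2) • F2 v := LinearMap.congr_fun (H2_eq b) v
  have h3 : csH b v = freeH v + ((2 / 3 : ℂ) * (1 - b ^ 2)) • F1 v + (1 - b ^ 2) • F2 v := by
    rw [csH_eq hb, LinearMap.add_apply, LinearMap.add_apply, h0, h1, h2]
  refine ⟨h0, h1, h2, h3, ?_⟩
  have h4 : Hd v + Ht v = (2 / 3 : ℂ) • F1 v + F2 v := LinearMap.congr_fun Hd_add_Ht v
  rw [h3, add_assoc, add_assoc, ← smul_add, h4]
  module
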